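/- Let $K\ge 2$ be the number of arms and $T\ge 1$ the number of rounds; $\ln$ is the natural logarithm. A bandit algorithm maps each finite arm--gain history to a distribution over the next arm. $\mathrm{EXP3}$ with parameter $\gamma\in[0,1]$ draws arm $i$ in its $n$-th round with probability $$p_{i,n}=(1-\gamma)\frac{\exp(\frac{\gamma}{K}\tilde G_{i,n-1})}{\sum_{j=1}^{K}\exp(\frac{\gamma}{K}\tilde G_{j,n-1})}+\frac{\gamma}{K},\qquad \tilde G_{i,n-1}=\sum_{s=1}^{n-1}\frac{x_s}{p_{i,s}}\mathbf 1\{Z_s=i\},$$ where $Z_s$ and $x_s$ are the arm it drew and the gain it was fed in its round $s$. $\mathrm{EXP3}_\tau$, for an integer $\tau\ge1$, splits the rounds $1,\dots,T$ into consecutive intervals of $\tau$ rounds (the last one may be shorter); at the start of each interval it draws an arm from $\mathrm{EXP3}$ and plays it throughout the interval, and at the end of the interval it feeds $\mathrm{EXP3}$ the average of the gains received in it. Here $\gamma=\min\bigl\{1,\sqrt{K\ln K/((e-1)T/\tau)}\bigr\}$, the usual choice for the $T/\tau$ rounds of $\mathrm{EXP3}$. An algorithm with arms $I_1,\dots,I_T$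 is $(\epsilon,\delta)$-differentially private up to round $T$ if for all gain sequences $g_{1:T-1},g'_{1:T-1}$ with $g_s,g'_s\in[0,1]^K$ that differ in at most one round, and all $S\subseteq\{1,\dots,K\}^T$, $\Pr(I_{1:T}\in S\mid g_{1:T-1})\le \delta+e^{\epsilon}\Pr(I_{1:T}\in S\mid g'_{1:T-1})$. The switching costs adversary chooses gains $g_{i,t}\in[0,1]$ in advance, possibly at random and independently of the agent's randomization; the agent receives $g_{I_1,1}$ in round $1$, and in round $t\ge2$ receives $g_{I_t,t}$ if $I_t=I_{t-1}$ and $0$ otherwise. The regret is $\max_i\sum_{t=1}^T g_{i,t}$, the total gain of the agent that always plays the best fixed arm, minus the total gain received; its expectation is over the random choices of both the agent and the adversary. Let $\tau=\lceil (7K\ln K)^{-1/3}T^{1/3}\rceil$. Then: (1) $\mathrm{EXP3}_\tau$ is $(\epsilon,T^{-2})$-differentially private up to round $T$ with $\epsilon=28K\ln K+\sqrt{112\,K\ln K\,\ln T}$. (2) For every switching costs adversary, the expected regret of $\mathrm{EXP3}_\tau$ over $T$ rounds is well defined and at most $$2(7K\ln K)^{1/3}T^{2/3}+(7K\ln K)^{-1/3}T^{1/3}.$$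 -/

import Mathlib

open MeasureTheory

namespace Bandit

/-- A randomized bandit algorithm on the arms `Fin K`: it maps every finite arm-gain history
(in chronological order) to a probability distribution over the next arm to take. -/
abbrev Algorithm (K : ℕ) : Type :=
  (n : ℕ) → (Fin n → Fin K × ℝ) → stdSimplex ℝ (Fin K)

/-- An adversary that fixes its gain functions in advance: `f t a` is the gain granted in the
round of index `t` (rounds have indices `0, 1, 2, …`) when the arms played in the rounds of
indices `0, …, t` are `a 0, …, a t`. -/
abbrev Adversary (K : ℕ) : Type :=
  (t : ℕ) → (Fin (t + 1) → Fin K) → ℝ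

/-- The oblivious adversary with gains `g t i` (round `t`, arm `i`). -/
def oblivious {K : ℕ} (g : ℕ → Fin K → ℝ) : Adversary K :=
  fun t a => g t (a (Fin.last t))

/-- The switching costs adversary with gains `g t i`: the agent receives the gain of the arm he
plays, except that he receives `0` in each round in which he switches arms. -/
def switchingCosts {K : ℕ} (g : ℕ → Fin K → ℝ) : Adversary K
  | 0, a => g 0 (a 0)
  | t + 1, a =>
      if a (Fin.last (t + 1)) = a (Fin.last t).castSucc then g (t + 1) (a (Fin.last (t + 1)))
      else 0

/-- The gain received in round `t` when the arms played are `a`. -/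
def gainAt {K T : ℕ} (f : Adversary K) (a : Fin T → Fin K) (t : Fin T) : ℝ :=
  f t (fun r => a (Fin.castLE t.isLt r))

/-- The arm-gain history observed before round `t` when the arms played are `a`. -/
def historyBefore {K T : ℕ} (f : Adversary K) (a : Fin T → Fin K) (t : Fin T) :
    Fin (t : ℕ) → Fin K × ℝ :=
  fun r => (a (Fin.castLE t.isLt.le r), gainAt f a (Fin.castLE t.isLt.le r))

/-- The probability that `L`, playing against `f`, plays exactly the arms `a` in the first `T`
rounds. -/
noncomputable def seqProb {K T : ℕ} (L : Algorithm K) (f : Adversary K)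
    (a : Fin T → Fin K) : ℝ :=
  ∏ t : Fin T, (L t (historyBefore f a t)).1 (a t)

/-- `(ε, δ)`-differential privacy up to round `T`: the arms `I_1, …, I_T` depend on the gains of
the first `T - 1` rounds, those with indices `s` such that `s + 1 < T`. -/
def IsDPUpTo {K : ℕ} (L : Algorithm K) (ε δ : ℝ) (T : ℕ) : Prop :=
  ∀ g g' : ℕ → Fin K → ℝ,
    (∀ s i, g s i ∈ Set.Icc (0 : ℝ) 1) → (∀ s i, g' s i ∈ Set.Icc (0 : ℝ) 1) →
    (∃ s₀ : ℕ, ∀ s : ℕ, s + 1 < T → s ≠ s₀ → g s = g' s) →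
    ∀ S : Finset (Fin T → Fin K),
      ∑ a ∈ S, seqProb L (oblivious g) a
        ≤ δ + Real.exp ε * ∑ a ∈ S, seqProb L (oblivious g') a

/-- The regret, over the rounds of a game in which the arms `a` were played, against the oracle
that always plays the best fixed arm. -/
noncomputable def regret {K T : ℕ} (f : Adversary K) (a : Fin T → Fin K) : ℝ :=
  (⨆ i : Fin K, ∑ t : Fin T, gainAt f (fun _ => i) t) - ∑ t : Fin T, gainAt f a t

/-- The expectation of the regret over `T` rounds with respect to the random choices of `L`,
for a given adversary. -/
noncomputable def agentRegret {K : ℕ} (L : Algorithm K) (f : Adversary K) (T : ℕ) : ℝ :=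
  ∑ a : Fin T → Fin K, seqProb L f a * regret f a

/-- The distribution that EXP3 plays when the estimated cumulative gains are `G`. -/
noncomputable def exp3Mix {K : ℕ} (γ : ℝ) (G : Fin K → ℝ) (i : Fin K) : ℝ :=
  (1 - γ) * (Real.exp (γ / K * G i) / ∑ j, Real.exp (γ / K * G j)) + γ / K

/-- The importance-weighted estimates of the cumulative gains that EXP3 maintains. -/
noncomputable def exp3Est {K : ℕ} (γ : ℝ) : (n : ℕ) → (Fin n → Fin K × ℝ) → Fin K → ℝ
  | 0, _ => fun _ => 0
  | n + 1, h => fun i =>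
      exp3Est γ n (fun r => h r.castSucc) i +
        if (h (Fin.last n)).1 = i then
          (h (Fin.last n)).2 / exp3Mix γ (exp3Est γ n (fun r => h r.castSucc)) i
        else 0

theorem exp3Mix_mem {K : ℕ} [NeZero K] (γ : ℝ) (h0 : 0 ≤ γ) (h1 : γ ≤ 1) (G : Fin K → ℝ) :
    exp3Mix γ G ∈ stdSimplex ℝ (Fin K) := by
  have hK : (K : ℝ) ≠ 0 := by exact_mod_cast NeZero.ne K
  have hS : 0 < ∑ j, Real.exp (γ / K * G j) :=
    Finset.sum_pos (fun _ _ => Real.exp_pos _) Finset.univ_nonempty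
  refine ⟨fun i => ?_, ?_⟩
  · have : 0 ≤ 1 - γ := by linarith
    unfold exp3Mix
    positivity
  · unfold exp3Mix
    rw [Finset.sum_add_distrib, ← Finset.mul_sum, ← Finset.sum_div, div_self hS.ne']
    simp only [Finset.sum_const, Finset.card_univ, Fintype.card_fin, nsmul_eq_mul]
    field_simp
    ring

/-- EXP3 with parameter `γ`. -/
noncomputable def exp3 {K : ℕ} [NeZero K] (γ : Set.Icc (0 : ℝ) 1) : Algorithm K :=
  fun n h => ⟨exp3Mix γ.1 (exp3Est γ.1 n h), exp3Mix_mem γ.1 γ.2.1 γ.2.2 _⟩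

/-- The standard value `min {1, √(K ln K / ((e - 1) N))}` of the parameter of EXP3 on `K` arms
for a horizon of `N` rounds. -/
noncomputable def exp3Rate (K : ℕ) (N : ℝ) : Set.Icc (0 : ℝ) 1 :=
  ⟨min 1 (Real.sqrt (K * Real.log K / ((Real.exp 1 - 1) * N))),
    le_min zero_le_one (Real.sqrt_nonneg _), min_le_left _ _⟩

theorem block_lt {n τ : ℕ} (j : Fin (n / τ)) (s : Fin τ) : (j : ℕ) * τ + s < n := by
  have h1 : ((j : ℕ) + 1) * τ ≤ n :=
    (Nat.mul_le_mul_right τ j.isLt).trans (Nat.div_mul_le_self n τ)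
  have h2 := s.isLt
  rw [Nat.add_mul, Nat.one_mul] at h1
  omega

theorem block_pos {n τ : ℕ} (j : Fin (n / τ)) : 0 < τ := by
  rcases Nat.eq_zero_or_pos τ with h | h
  · subst h
    exact absurd j.isLt (by simp)
  · exact h

theorem block_start_lt {n τ : ℕ} (h : n % τ ≠ 0) : n / τ * τ < n := by
  have h1 := Nat.div_add_mod' n τ
  omega

/-- The history of a base algorithm that is run on the completed intervals of `τ` rounds: each
interval contributes the arm played in it and the average of the gains received in it. -/
noncomputable def batchHistory {K : ℕ} (τ n : ℕ) (h : Fin n → Fin K × ℝ) :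
    Fin (n / τ) → Fin K × ℝ :=
  fun j =>
    ((h ⟨(j : ℕ) * τ + (⟨0, block_pos j⟩ : Fin τ), block_lt j _⟩).1,
      (∑ s : Fin τ, (h ⟨(j : ℕ) * τ + s, block_lt j s⟩).2) / τ)

/-- The mini-batched version of `L`: at the beginning of each interval of `τ` rounds an arm is
drawn from `L`, run on the completed intervals; during the interval that arm is repeated. -/
noncomputable def miniBatch {K : ℕ} (τ : ℕ) (L : Algorithm K) : Algorithm K :=
  fun n h =>
    if hn : n % τ = 0 then L (n / τ) (batchHistory τ n h)
    else ⟨Pi.single (h ⟨n / τ * τ, block_start_lt hn⟩).1 1, single_mem_stdSimplex ℝ _⟩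

/-- EXP3 in a mini-batch loop with intervals of `τ` rounds, for a game of `T` rounds; the base
EXP3 is tuned for its `T / τ` rounds. -/
noncomputable def exp3Tau (K : ℕ) [NeZero K] (T τ : ℕ) : Algorithm K :=
  miniBatch τ (exp3 (exp3Rate K ((T : ℝ) / τ)))

end Bandit

namespace Bandit

open Finset

/-! Mini-batching does two jobs: only about `T / τ` arms are drawn afresh, and each gain reaches
EXP3 divided by `τ`.

Privacy. The number `η = γ / K` is both the learning rate and the exploration floor of EXP3. Because
the two agree, the update `G i + x / p i` of the played arm is monotone in all of `G`
(`add_div_exp3Mix_mono`); it also commutes with adding a constant to `G`. So estimates lying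
coordinatewise between `G` and `G + D` keep this property under common feedback. A change of one fed
gain by `d` therefore moves all later estimates in one direction by at most `d / η`
(`exp3Est_stable`), and each conditional probability by a factor of at most `exp d`, with `d = 1 /
τ`. Rényi moments multiply along the draws, and a Markov argument turns them into (ε, δ)-privacy
(`sum_seqProb_le_of_ratio`). With `V = 7 K ln K` and `T ≤ V τ ^ 3`, the number of draws times `d ^
2` is at most `2 V`.

Regret. Inside an interval only the first round can be a switch. The averaged adversary seen by EXP3
is adaptive, but it grants arm `i` at least (gain of `i` in the interval − 1) / `τ` whatever was
played before, and this is all that the exponential-weights analysis needs (`exp3_gain_ge`). The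
total loss is at most one unit per complete interval, `τ` times the EXP3 regret, about `2 √((e - 1)
τ T K ln K)`, and the rounds of an incomplete interval. For `τ ≈ (T / V) ^ (1/3)`, since `4 (e - 1)
≤ 7`, the first two terms are each about `V ^ (1/3) T ^ (2/3)` or less. -/

/-! ### Elementary inequalities and the Rényi moment of one draw -/

theorem exp_le_one_add_add_sq {y : ℝ} (h0 : 0 ≤ y) (h1 : y ≤ 1) :
    Real.exp y ≤ 1 + y + (Real.exp 1 - 2) * y ^ 2 := by
  have hs : ∀ x : ℝ, HasSum (fun n : ℕ => x ^ (n + 2) / ((n + 2).factorial : ℝ))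
      (Real.exp x - (1 + x)) := by
    intro x
    have h := NormedSpace.expSeries_div_hasSum_exp (𝔸 := ℝ) x
    rw [← Real.exp_eq_exp_ℝ, ← hasSum_nat_add_iff' 2] at h
    simpa [Finset.sum_range_succ] using h
  -- The power series tails are compared termwise, by `y ^ (n + 2) ≤ y ^ 2`; the tail at `1` sums to
  -- `e - 2`.
  have h := hasSum_le (fun n => ?_) (hs y) ((hs 1).mul_right (y ^ 2))
  · linarith
  · rw [one_pow, div_mul_eq_mul_div, one_mul, pow_add]
    gcongr
    exact mul_le_of_le_one_left (sq_nonneg y) (pow_le_one₀ h0 h1)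

theorem sinh_le_mul_cosh {x : ℝ} (hx : 0 ≤ x) : Real.sinh x ≤ x * Real.cosh x := by
  have hd : ∀ y : ℝ, HasDerivAt (fun y => y * Real.cosh y - Real.sinh y) (y * Real.sinh y) y := by
    intro y
    exact (((hasDerivAt_id' y).mul (Real.hasDerivAt_cosh y)).sub
      (Real.hasDerivAt_sinh y)).congr_deriv (by ring)
  have hm : MonotoneOn (fun y => y * Real.cosh y - Real.sinh y) (Set.Ici 0) := by
    refine monotoneOn_of_deriv_nonneg (convex_Ici 0)
      (fun y _ => (hd y).continuousAt.continuousWithinAt)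
      (fun y _ => (hd y).differentiableAt.differentiableWithinAt) fun y hy => ?_
    rw [interior_Ici] at hy
    rw [(hd y).deriv]
    exact mul_nonneg (le_of_lt hy) (Real.sinh_nonneg_iff.2 (le_of_lt hy))
  have h := hm (Set.mem_Ici.2 le_rfl) (Set.mem_Ici.2 hx) hx
  simp only [Real.sinh_zero, zero_mul, sub_zero] at h
  linarith

theorem cosh_add_le {a b : ℝ} (ha : 0 ≤ a) (hb : 0 ≤ b) :
    Real.cosh (a + b) ≤ Real.cosh b * Real.exp (a * b + a ^ 2 / 2) := by
  have h1 := sinh_le_mul_cosh ha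
  have h2 := sinh_le_mul_cosh hb
  have hca := Real.cosh_pos a
  have hcb := Real.cosh_pos b
  calc Real.cosh (a + b) = Real.cosh a * Real.cosh b + Real.sinh a * Real.sinh b :=
        Real.cosh_add a b
    _ ≤ Real.cosh a * Real.cosh b + (a * Real.cosh a) * (b * Real.cosh b) := by
        gcongr
    _ = Real.cosh b * ((a * b + 1) * Real.cosh a) := by ring
    _ ≤ Real.cosh b * (Real.exp (a * b) * Real.exp (a ^ 2 / 2)) := by
        gcongr
        · exact Real.add_one_le_exp _
        · exact Real.cosh_le_exp_half_sq a
    _ = _ := by rw [Real.exp_add]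

/-- The Rényi divergence of two distributions with likelihood ratios in `[e⁻ᵈ, eᵈ]`. -/
theorem sum_mul_div_rpow_le {ι : Type*} [Fintype ι] {p q : ι → ℝ} {d l : ℝ} (hd : 0 < d)
    (hl : 0 ≤ l) (hq : ∀ i, 0 < q i) (hps : ∑ i, p i = 1)
    (hqs : ∑ i, q i = 1) (hpq : ∀ i, p i ≤ Real.exp d * q i)
    (hqp : ∀ i, q i ≤ Real.exp d * p i) :
    ∑ i, p i * (p i / q i) ^ l ≤ Real.exp (d ^ 2 * (l * (1 + l)) / 2) := by
  set E := Real.exp d with hE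
  set E' := Real.exp (-d) with hE'
  have hEE : E * E' = 1 := by rw [hE, hE', ← Real.exp_add]; simp
  have hE0 : 0 < E := Real.exp_pos _
  have hE'0 : 0 < E' := Real.exp_pos _
  have hlt : E' < E := Real.exp_lt_exp.2 (by linarith)
  have hE'1 : E' < 1 := Real.exp_lt_one_iff.2 (by linarith)
  have hc := convexOn_rpow (p := 1 + l) (by linarith)
  -- The convex function `r ^ (1 + l)` of the ratio `r = p i / q i` lies below its chord over `[exp
  -- (-d), exp d]`.
  have hpt : ∀ i, p i * (p i / q i) ^ l ≤
      ((E * q i - p i) * E' ^ (1 + l) + (p i - E' * q i) * E ^ (1 + l)) / (E - E') := by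
    intro i
    have hp : 0 < p i := pos_of_mul_pos_right ((hq i).trans_le (hqp i)) hE0.le
    have hr1 : p i / q i ≤ E := by rw [div_le_iff₀ (hq i)]; exact hpq i
    have hr2 : E' ≤ p i / q i := by
      rw [le_div_iff₀ (hq i)]
      calc E' * q i ≤ E' * (E * p i) := by gcongr; exact hqp i
        _ = p i := by rw [← mul_assoc, mul_comm E', hEE, one_mul]
    have hs : 0 < E - E' := by linarith
    have ha : 0 ≤ (E - p i / q i) / (E - E') := div_nonneg (by linarith) hs.le
    have hb : 0 ≤ (p i / q i - E') / (E - E') := div_nonneg (by linarith) hs.le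
    have h := hc.2 (Set.mem_Ici.2 hE'0.le) (Set.mem_Ici.2 hE0.le) ha hb
      (by rw [← add_div, div_eq_one_iff_eq hs.ne']; ring)
    simp only [smul_eq_mul] at h
    have he : (E - p i / q i) / (E - E') * E' + (p i / q i - E') / (E - E') * E = p i / q i := by
      have := (hq i).ne'
      field_simp
      ring
    rw [he, Real.rpow_add (div_pos hp (hq i)), Real.rpow_one] at h
    have h2 := mul_le_mul_of_nonneg_left h (hq i).le
    have hne := (hq i).ne'
    calc p i * (p i / q i) ^ l = q i * (p i / q i * (p i / q i) ^ l) := by field_simp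
      _ ≤ _ := h2
      _ = _ := by field_simp
  -- The chord is affine and the ratio has `q`-mean 1, so only the extremal two-point law remains:
  -- its moment is `cosh (d l + d / 2) / cosh (d / 2)`.
  have hsum : ∑ i, ((E * q i - p i) * E' ^ (1 + l) + (p i - E' * q i) * E ^ (1 + l)) / (E - E')
      = (E * E' ^ (1 + l) + E ^ (1 + l)) / (E + 1) := by
    rw [← Finset.sum_div, Finset.sum_add_distrib, ← Finset.sum_mul, ← Finset.sum_mul,
      Finset.sum_sub_distrib, Finset.sum_sub_distrib, ← Finset.mul_sum, ← Finset.mul_sum, hps, hqs]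
    rw [div_eq_div_iff (by linarith) (by linarith)]
    linear_combination (E' ^ (1 + l) - E ^ (1 + l)) * hEE
  refine (Finset.sum_le_sum fun i _ => hpt i).trans (hsum.trans_le ?_)
  rw [div_le_iff₀ (by linarith), hE, hE', ← Real.exp_mul, ← Real.exp_mul, ← Real.exp_add]
  have h := cosh_add_le (a := d * l) (b := d / 2) (by positivity) (by positivity)
  have h' := mul_le_mul_of_nonneg_left h (Real.exp_pos (d / 2)).le
  rw [Real.cosh_eq, Real.cosh_eq] at h'
  have e1 : Real.exp (d / 2) * ((Real.exp (d * l + d / 2) + Real.exp (-(d * l + d / 2))) / 2)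
      = (Real.exp (d * (1 + l)) + Real.exp (d + -d * (1 + l))) / 2 := by
    rw [mul_div_assoc', mul_add, ← Real.exp_add, ← Real.exp_add]
    ring_nf
  have e2 : Real.exp (d / 2) * ((Real.exp (d / 2) + Real.exp (-(d / 2))) / 2 *
      Real.exp (d * l * (d / 2) + (d * l) ^ 2 / 2))
      = Real.exp (d ^ 2 * (l * (1 + l)) / 2) * (Real.exp d + 1) / 2 := by
    rw [← mul_assoc, mul_div_assoc', mul_add, ← Real.exp_add, ← Real.exp_add]
    rw [show d / 2 + d / 2 = d by ring, show d / 2 + -(d / 2) = 0 by ring, Real.exp_zero]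
    ring_nf
  rw [e1, e2] at h'
  linarith

/-! ### Laws of arm sequences -/

/-- The product of the weights `w` along the sequence `a`, where the weight of an entry may depend
on all previous entries. -/
def pathProd {K : ℕ} (w : (t : ℕ) → (Fin t → Fin K) → Fin K → ℝ) {T : ℕ} (a : Fin T → Fin K) : ℝ :=
  ∏ t : Fin T, w t (fun r => a (Fin.castLE t.isLt.le r)) (a t)

/-- The complete arm-gain history when the arms played against `f` are `a`. -/
def hist {K : ℕ} (f : Adversary K) {n : ℕ} (a : Fin n → Fin K) : Fin n → Fin K × ℝ :=
  fun r => (a r, gainAt f a r)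

section path

variable {K : ℕ} (w : (t : ℕ) → (Fin t → Fin K) → Fin K → ℝ)

theorem pathProd_snoc {T : ℕ} (a : Fin T → Fin K) (i : Fin K) :
    pathProd w (Fin.snoc a i : Fin (T + 1) → Fin K) = pathProd w a * w T a i := by
  have h : ∀ (n : ℕ) (hn : n ≤ T) (r : Fin n),
      (Fin.snoc a i : Fin (T + 1) → Fin K) (Fin.castLE (hn.trans T.le_succ) r)
        = a (Fin.castLE hn r) := fun n hn r =>
    Fin.snoc_castSucc (α := fun _ => Fin K) i a (Fin.castLE hn r)
  unfold pathProd
  rw [Fin.prod_univ_castSucc, Fin.snoc_last]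
  congr 1
  · refine Finset.prod_congr rfl fun t _ => ?_
    rw [Fin.snoc_castSucc]
    congr 1
    funext r
    exact h t t.isLt.le r
  · congr 1
    funext r
    exact h T le_rfl r

theorem sum_snoc {M : Type*} [AddCommMonoid M] {T : ℕ} (F : (Fin (T + 1) → Fin K) → M) :
    ∑ a, F a = ∑ a : Fin T → Fin K, ∑ i, F (Fin.snoc a i) := by
  rw [← (Fin.snocEquiv fun _ : Fin (T + 1) => Fin K).sum_comp, Fintype.sum_prod_type,
    Finset.sum_comm]
  rfl

theorem sum_pathProd_succ {T : ℕ} (F : (Fin (T + 1) → Fin K) → ℝ) :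
    ∑ a, pathProd w a * F a
      = ∑ a : Fin T → Fin K, pathProd w a * ∑ i, w T a i * F (Fin.snoc a i) := by
  rw [sum_snoc]
  simp_rw [pathProd_snoc, Finset.mul_sum, mul_assoc]

variable {w}

/-- The last entry is summed out first, with a bound uniform in the past. The weights need not be
normalised, so the lemma applies to Rényi moments as well. -/
theorem sum_pathProd_le_pow {C : ℝ} {T : ℕ} (h0 : ∀ t a i, 0 ≤ w t a i) (hC : 0 ≤ C)
    (hw : ∀ t, t < T → ∀ a, ∑ i, w t a i ≤ C) :
    ∑ a : Fin T → Fin K, pathProd w a ≤ C ^ T := by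
  induction T with
  | zero => simp [pathProd]
  | succ T ih =>
    have h := sum_pathProd_succ w (T := T) (fun _ => 1)
    simp only [mul_one] at h
    rw [h, pow_succ]
    refine le_trans ?_ (mul_le_mul_of_nonneg_right (ih fun t ht => hw t (ht.trans T.lt_succ_self)) hC)
    rw [Finset.sum_mul]
    exact Finset.sum_le_sum fun a _ => mul_le_mul_of_nonneg_left (hw T T.lt_succ_self a)
      (Finset.prod_nonneg fun t _ => h0 _ _ _)

end path

section seqProb

variable {K : ℕ} (L : Algorithm K) (f : Adversary K)

theorem seqProb_nonneg {T : ℕ} (a : Fin T → Fin K) : 0 ≤ seqProb L f a :=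
  Finset.prod_nonneg fun _ _ => (L _ _).2.1 _

theorem sum_seqProb_succ {T : ℕ} (F : (Fin (T + 1) → Fin K) → ℝ) :
    ∑ a, seqProb L f a * F a
      = ∑ a : Fin T → Fin K, seqProb L f a * ∑ i, (L T (hist f a)).1 i * F (Fin.snoc a i) :=
  sum_pathProd_succ (fun t a i => (L t (hist f a)).1 i) F

theorem sum_seqProb_castSucc {T : ℕ} (F : (Fin T → Fin K) → ℝ) :
    ∑ a : Fin (T + 1) → Fin K, seqProb L f a * F (fun r => a r.castSucc)
      = ∑ a, seqProb L f a * F a := by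
  rw [sum_seqProb_succ]
  refine Finset.sum_congr rfl fun a _ => ?_
  simp only [Fin.snoc_castSucc]
  rw [← Finset.sum_mul, (L T _).2.2, one_mul]

/-- Later arms integrate out, because each conditional distribution sums to one. -/
theorem sum_seqProb_castLE {m T : ℕ} (h : m ≤ T) (F : (Fin m → Fin K) → ℝ) :
    ∑ a : Fin T → Fin K, seqProb L f a * F (fun r => a (Fin.castLE h r))
      = ∑ a, seqProb L f a * F a := by
  induction T, h using Nat.le_induction with
  | base => rfl
  | succ T h ih =>
    exact (sum_seqProb_castSucc L f fun a : Fin T → Fin K => F fun r => a (Fin.castLE h r)).trans ih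

theorem sum_seqProb (T : ℕ) : ∑ a : Fin T → Fin K, seqProb L f a = 1 := by
  have h := sum_seqProb_castLE L f (Nat.zero_le T) (fun _ => 1)
  simp only [mul_one] at h
  rw [h]
  simp [seqProb]

theorem gainAt_snoc_castSucc {T : ℕ} (a : Fin T → Fin K) (i : Fin K) (t : Fin T) :
    gainAt f (Fin.snoc a i : Fin (T + 1) → Fin K) t.castSucc = gainAt f a t := by
  unfold gainAt
  congr 1
  funext r
  exact Fin.snoc_castSucc (α := fun _ => Fin K) i a (Fin.castLE t.isLt r)

theorem gainAt_snoc_last {T : ℕ} (a : Fin T → Fin K) (i : Fin K) :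
    gainAt f (Fin.snoc a i : Fin (T + 1) → Fin K) (Fin.last T) = f T (Fin.snoc a i) := rfl

theorem hist_snoc_castSucc {T : ℕ} (a : Fin T → Fin K) (i : Fin K) :
    (fun r : Fin T => hist f (Fin.snoc a i : Fin (T + 1) → Fin K) r.castSucc) = hist f a := by
  funext r
  simp only [hist, gainAt_snoc_castSucc, Fin.snoc_castSucc]

theorem hist_snoc_last {T : ℕ} (a : Fin T → Fin K) (i : Fin K) :
    hist f (Fin.snoc a i : Fin (T + 1) → Fin K) (Fin.last T) = (i, f T (Fin.snoc a i)) := by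
  simp only [hist, gainAt_snoc_last, Fin.snoc_last]

end seqProb

/-! ### Stability of the EXP3 estimates -/

theorem exp3Mix_add_const {K : ℕ} {γ : ℝ} (G : Fin K → ℝ) (D : ℝ) (i : Fin K) :
    exp3Mix γ (fun j => G j + D) i = exp3Mix γ G i := by
  unfold exp3Mix
  simp only [mul_add, Real.exp_add]
  rw [← Finset.sum_mul, mul_div_mul_right _ _ (Real.exp_pos _).ne']

section mix

variable {K : ℕ} [NeZero K] {γ : ℝ}

theorem sum_exp_pos (y : Fin K → ℝ) : 0 < ∑ j, Real.exp (y j) :=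
  Finset.sum_pos (fun _ _ => Real.exp_pos _) Finset.univ_nonempty

theorem cast_pos_of_neZero : (0 : ℝ) < K := by exact_mod_cast NeZero.pos K

theorem le_exp3Mix (h1 : γ ≤ 1) (G : Fin K → ℝ) (i : Fin K) : γ / K ≤ exp3Mix γ G i := by
  have h : 0 ≤ 1 - γ := by linarith
  unfold exp3Mix
  have := sum_exp_pos (fun j => γ / K * G j)
  have : 0 ≤ (1 - γ) * (Real.exp (γ / K * G i) / ∑ j, Real.exp (γ / K * G j)) := by positivity
  linarith

theorem exp3Mix_pos (h0 : 0 < γ) (h1 : γ ≤ 1) (G : Fin K → ℝ) (i : Fin K) : 0 < exp3Mix γ G i :=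
  (div_pos h0 cast_pos_of_neZero).trans_le (le_exp3Mix h1 G i)

/-- A weight of the exponential distribution grows at most by the factor by which its numerator
grows. -/
theorem softmax_le_of_le (h0 : 0 ≤ γ) {G G' : Fin K → ℝ} (h : ∀ j, G j ≤ G' j) {i : Fin K}
    {D : ℝ} (hi : G' i ≤ G i + D) :
    Real.exp (γ / K * G' i) / ∑ j, Real.exp (γ / K * G' j)
      ≤ Real.exp (γ / K * D) * (Real.exp (γ / K * G i) / ∑ j, Real.exp (γ / K * G j)) := by
  have hη : 0 ≤ γ / K := by positivity
  rw [mul_div_assoc', ← Real.exp_add, ← mul_add]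
  have := sum_exp_pos (fun j => γ / K * G j)
  gcongr with j _
  · linarith
  · exact h j

theorem exp3Mix_le_of_le (h0 : 0 ≤ γ) (h1 : γ ≤ 1) {G G' : Fin K → ℝ} (h : ∀ j, G j ≤ G' j)
    {i : Fin K} {D : ℝ} (hD : 0 ≤ D) (hi : G' i ≤ G i + D) :
    exp3Mix γ G' i ≤ Real.exp (γ / K * D) * exp3Mix γ G i := by
  have hη : 0 ≤ γ / K := by positivity
  have h2 : 1 ≤ Real.exp (γ / K * D) := Real.one_le_exp (by positivity)
  have h3 := mul_le_mul_of_nonneg_left (softmax_le_of_le h0 h hi) (sub_nonneg.2 h1)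
  unfold exp3Mix
  nlinarith [mul_le_mul_of_nonneg_right h2 hη]

theorem exp3Mix_le_of_mem_Icc (h0 : 0 ≤ γ) (h1 : γ ≤ 1) {G G' : Fin K → ℝ} {D : ℝ} (hD : 0 ≤ D)
    (h : ∀ j, G j ≤ G' j ∧ G' j ≤ G j + D) (i : Fin K) :
    exp3Mix γ G' i ≤ Real.exp (γ / K * D) * exp3Mix γ G i ∧
      exp3Mix γ G i ≤ Real.exp (γ / K * D) * exp3Mix γ G' i := by
  refine ⟨exp3Mix_le_of_le h0 h1 (fun j => (h j).1) hD (h i).2, ?_⟩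
  rw [← exp3Mix_add_const G D]
  exact exp3Mix_le_of_le h0 h1 (fun j => (h j).2) hD (by linarith [(h i).1])

/-- The update of the estimate of the arm that is played is monotone in all estimates. -/
theorem add_div_exp3Mix_mono (h0 : 0 < γ) (h1 : γ ≤ 1) {G G' : Fin K → ℝ} (h : ∀ j, G j ≤ G' j)
    (i : Fin K) {x : ℝ} (hx0 : 0 ≤ x) (hx1 : x ≤ 1) :
    G i + x / exp3Mix γ G i ≤ G' i + x / exp3Mix γ G' i := by
  have hη : 0 < γ / K := div_pos h0 cast_pos_of_neZero
  have hp := exp3Mix_pos h0 h1 G i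
  have hp' := exp3Mix_pos h0 h1 G' i
  set η := γ / (K : ℝ) with hηd
  set u := η * (G' i - G i) with hu
  have hu0 : 0 ≤ u := mul_nonneg hη.le (sub_nonneg.2 (h i))
  set s := (1 - γ) * (Real.exp (η * G i) / ∑ j, Real.exp (η * G j)) with hs
  have hs0 : 0 ≤ s := by
    have := sum_exp_pos (fun j => η * G j)
    have : 0 ≤ 1 - γ := by linarith
    positivity
  have hpd : exp3Mix γ G i = s + η := rfl
  have hp'd : exp3Mix γ G' i ≤ s * Real.exp u + η := by
    have h3 := mul_le_mul_of_nonneg_left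
      (softmax_le_of_le h0.le h (i := i) (D := G' i - G i) (by linarith)) (sub_nonneg.2 h1)
    unfold exp3Mix
    rw [← hηd] at h3 ⊢
    rw [hs]
    linarith
  have he1 : 1 ≤ Real.exp u := Real.one_le_exp hu0
  have he2 : 1 - Real.exp (-u) ≤ u := by linarith [Real.add_one_le_exp (-u)]
  -- Raising the estimate by `u / η` multiplies the exponential part `s` of the probability by at
  -- most `exp u`. The exploration term `η` in the denominators then bounds the drop of `1 / p` by
  -- `(1 - exp (-u)) / η`, hence by the raise itself.
  have key : 1 / exp3Mix γ G i - 1 / exp3Mix γ G' i ≤ u / η := by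
    calc 1 / exp3Mix γ G i - 1 / exp3Mix γ G' i ≤ 1 / (s + η) - 1 / (s * Real.exp u + η) := by
          rw [hpd]
          gcongr
      _ ≤ (1 - Real.exp (-u)) / η := by
          rw [div_sub_div _ _ (by positivity) (by positivity), div_le_div_iff₀ (by positivity) hη]
          have he : Real.exp (-u) * Real.exp u = 1 := by rw [← Real.exp_add]; simp
          have he3 : 0 ≤ 1 - Real.exp (-u) := by
            linarith [Real.exp_le_one_iff.2 (neg_nonpos.2 hu0)]
          have e1 : (1 * (s * Real.exp u + η) - (s + η) * 1) * η
              = (1 - Real.exp (-u)) * (s * Real.exp u * η) := by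
            linear_combination (s * η) * he
          rw [e1]
          refine mul_le_mul_of_nonneg_left ?_ he3
          have : 0 ≤ s * (s * Real.exp u) + s * η + η * η := by positivity
          nlinarith
      _ ≤ u / η := by gcongr
  have hui : u / η = G' i - G i := by rw [hu, mul_div_cancel_left₀ _ hη.ne']
  rw [hui] at key
  have hge := sub_nonneg.2 (h i)
  have h5 : x * (1 / exp3Mix γ G i - 1 / exp3Mix γ G' i) ≤ G' i - G i := by
    rcases le_total 0 (1 / exp3Mix γ G i - 1 / exp3Mix γ G' i) with hc | hc
    · nlinarith
    · nlinarith
  have e3 : x * (1 / exp3Mix γ G i - 1 / exp3Mix γ G' i)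
      = x / exp3Mix γ G i - x / exp3Mix γ G' i := by ring
  linarith

end mix

section est

variable {K : ℕ} [NeZero K] {γ : ℝ}

/-- The upper half is monotonicity applied to `G'` and `G + D`, since `exp3Mix` does not change when
a constant is added to all estimates. -/
theorem exp3Est_succ_mono (h0 : 0 < γ) (h1 : γ ≤ 1) {G G' : Fin K → ℝ}
    {D : ℝ} (h : ∀ j, G j ≤ G' j ∧ G' j ≤ G j + D) (i : Fin K) {x : ℝ} (hx0 : 0 ≤ x) (hx1 : x ≤ 1)
    (j : Fin K) :
    (G j + if i = j then x / exp3Mix γ G j else 0) ≤ (G' j + if i = j then x / exp3Mix γ G' j else 0)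
      ∧ (G' j + if i = j then x / exp3Mix γ G' j else 0)
        ≤ (G j + if i = j then x / exp3Mix γ G j else 0) + D := by
  split_ifs with hij
  · refine ⟨add_div_exp3Mix_mono h0 h1 (fun j => (h j).1) j hx0 hx1, ?_⟩
    have := add_div_exp3Mix_mono h0 h1 (fun j => (h j).2) j hx0 hx1
    rw [exp3Mix_add_const] at this
    linarith
  · simpa using h j

/-- If one of the gains fed to EXP3 changes by at most `d`, then all later estimates change in the
same direction, by at most `d K / γ`. -/
theorem exp3Est_stable (h0 : 0 < γ) (h1 : γ ≤ 1) {d : ℝ} (hd : 0 ≤ d) (b : ℕ) (n : ℕ)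
    (h h' : Fin n → Fin K × ℝ) (ha : ∀ r, (h r).1 = (h' r).1)
    (hx : ∀ r, (h r).2 ∈ Set.Icc (0 : ℝ) 1)
    (hne : ∀ r : Fin n, (r : ℕ) ≠ b → (h r).2 = (h' r).2)
    (hb : ∀ r : Fin n, |(h r).2 - (h' r).2| ≤ d) :
    (∀ j, exp3Est γ n h j ≤ exp3Est γ n h' j ∧
        exp3Est γ n h' j ≤ exp3Est γ n h j + d * (K / γ)) ∨
      (∀ j, exp3Est γ n h' j ≤ exp3Est γ n h j ∧
        exp3Est γ n h j ≤ exp3Est γ n h' j + d * (K / γ)) := by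
  have hK : (0 : ℝ) < K := cast_pos_of_neZero
  induction n with
  | zero =>
    left
    intro j
    simp only [exp3Est]
    exact ⟨le_rfl, by positivity⟩
  | succ n ih =>
    -- At the changed round the past estimates coincide, and `p ≥ γ / K` bounds the jump. At any
    -- other round the two sides receive the same feedback, and the order interval is preserved.
    by_cases hn : n = b
    · have heq : (fun r : Fin n => h r.castSucc) = fun r => h' r.castSucc := by
        funext r
        refine Prod.ext (ha _) (hne _ ?_)
        have := r.isLt
        simp only [Fin.val_castSucc]
        omega
      have hl := hb (Fin.last n)
      rw [abs_le] at hl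
      have hpi : ∀ G j, 1 / exp3Mix γ G j ≤ (K : ℝ) / γ := fun G j => by
        rw [← one_div_div γ]
        exact one_div_le_one_div_of_le (div_pos h0 hK) (le_exp3Mix h1 G j)
      have key : ∀ (x x' : ℝ) (G : Fin K → ℝ) j, x ≤ x' → x' ≤ x + d →
          x / exp3Mix γ G j ≤ x' / exp3Mix γ G j ∧
            x' / exp3Mix γ G j ≤ x / exp3Mix γ G j + d * (K / γ) := by
        intro x x' G j h2 h3
        have hp := exp3Mix_pos h0 h1 G j
        refine ⟨by gcongr, ?_⟩
        calc x' / exp3Mix γ G j ≤ (x + d) / exp3Mix γ G j := by gcongr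
          _ = x / exp3Mix γ G j + d * (1 / exp3Mix γ G j) := by ring
          _ ≤ _ := by linarith [mul_le_mul_of_nonneg_left (hpi G j) hd]
      have hd' : 0 ≤ d * (K / γ) := by positivity
      rcases le_total (h (Fin.last n)).2 (h' (Fin.last n)).2 with hle | hle
      · left
        intro j
        simp only [exp3Est, heq, ha]
        split_ifs
        · have := key _ _ (exp3Est γ n fun r => h' r.castSucc) j hle (by linarith)
          constructor <;> linarith
        · constructor <;> linarith
      · right
        intro j
        simp only [exp3Est, heq, ha]
        split_ifs
        · have := key _ _ (exp3Est γ n fun r => h' r.castSucc) j hle (by linarith)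
          constructor <;> linarith
        · constructor <;> linarith
    · have hl := hne (Fin.last n) (by simpa using hn)
      have hxl := hx (Fin.last n)
      have := ih (fun r => h r.castSucc) (fun r => h' r.castSucc) (fun r => ha _) (fun r => hx _)
        (fun r hr => hne _ (by simpa using hr)) (fun r => hb _)
      simp only [exp3Est, ha, hl] at this ⊢
      rw [hl] at hxl
      rcases this with h2 | h2
      · exact Or.inl fun j => exp3Est_succ_mono h0 h1 h2 _ hxl.1 hxl.2 j
      · exact Or.inr fun j => exp3Est_succ_mono h0 h1 h2 _ hxl.1 hxl.2 j

end est

/-! ### Composition and privacy of EXP3 -/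

/-- Markov's inequality in pointwise form: where `P` exceeds `exp ε * Q`, the factor `(P / Q) ^ l`
is at least `exp (l * ε)`. -/
theorem rpow_tail {P Q ε l : ℝ} (hP : 0 ≤ P) (hQ : 0 < Q) (hl : 0 ≤ l) :
    P ≤ Real.exp ε * Q + Real.exp (-(l * ε)) * (P * (P / Q) ^ l) := by
  have h0 : 0 ≤ Real.exp (-(l * ε)) * (P * (P / Q) ^ l) := by positivity
  rcases le_total P (Real.exp ε * Q) with h | h
  · linarith
  · have h1 : Real.exp ε ≤ P / Q := by rwa [le_div_iff₀ hQ]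
    have h2 : Real.exp (l * ε) ≤ (P / Q) ^ l := by
      rw [mul_comm, Real.exp_mul]
      gcongr
    have h3 : P ≤ Real.exp (-(l * ε)) * (P * (P / Q) ^ l) := by
      calc P = Real.exp (-(l * ε)) * (P * Real.exp (l * ε)) := by
            rw [mul_left_comm, ← Real.exp_add]; simp
        _ ≤ _ := by gcongr
    have : 0 < Real.exp ε * Q := by positivity
    linarith

/-- Composition: if each conditional distribution changes by a factor of at most `eᵈ`, then the
laws of the first `N` arms are close up to an additive error. -/
theorem sum_seqProb_le_of_ratio {K : ℕ} (L : Algorithm K) (f f' : Adversary K) {d l ε : ℝ} {N : ℕ}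
    (hd : 0 < d) (hl : 0 ≤ l) (hpos : ∀ n h i, 0 < (L n h).1 i)
    (hr : ∀ n, n < N → ∀ (a : Fin n → Fin K) i,
      (L n (hist f a)).1 i ≤ Real.exp d * (L n (hist f' a)).1 i ∧
        (L n (hist f' a)).1 i ≤ Real.exp d * (L n (hist f a)).1 i)
    (S : Finset (Fin N → Fin K)) :
    ∑ a ∈ S, seqProb L f a ≤ Real.exp (N * (d ^ 2 * (l * (1 + l)) / 2) - l * ε)
      + Real.exp ε * ∑ a ∈ S, seqProb L f' a := by
  have hP : ∀ (f : Adversary K) (a : Fin N → Fin K), 0 < seqProb L f a := fun f a =>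
    Finset.prod_pos fun t _ => hpos _ _ _
  set w : (t : ℕ) → (Fin t → Fin K) → Fin K → ℝ := fun t a i =>
    (L t (hist f a)).1 i * ((L t (hist f a)).1 i / (L t (hist f' a)).1 i) ^ l with hw
  have hw0 : ∀ t a i, 0 ≤ w t a i := fun t a i =>
    mul_nonneg (hpos _ _ _).le (Real.rpow_nonneg (div_nonneg (hpos _ _ _).le (hpos _ _ _).le) _)
  have hprod : ∀ a : Fin N → Fin K,
      seqProb L f a * (seqProb L f a / seqProb L f' a) ^ l = pathProd w a := by
    intro a
    unfold seqProb pathProd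
    rw [← Finset.prod_div_distrib, ← Real.finsetProd_rpow, ← Finset.prod_mul_distrib]
    · rfl
    · exact fun t _ => div_nonneg (hpos _ _ _).le (hpos _ _ _).le
  have hmom : ∑ a : Fin N → Fin K, pathProd w a
      ≤ Real.exp (N * (d ^ 2 * (l * (1 + l)) / 2)) := by
    rw [Real.exp_nat_mul]
    refine sum_pathProd_le_pow hw0 (Real.exp_pos _).le fun t ht a => ?_
    exact sum_mul_div_rpow_le hd hl (fun i => hpos _ _ _) (L t _).2.2 (L t _).2.2
      (fun i => (hr t ht a i).1) (fun i => (hr t ht a i).2)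
  calc ∑ a ∈ S, seqProb L f a
      ≤ ∑ a ∈ S, (Real.exp ε * seqProb L f' a + Real.exp (-(l * ε)) * pathProd w a) :=
        Finset.sum_le_sum fun a _ => by
          rw [← hprod]
          exact rpow_tail (hP f a).le (hP f' a) hl
    _ = Real.exp ε * ∑ a ∈ S, seqProb L f' a + Real.exp (-(l * ε)) * ∑ a ∈ S, pathProd w a := by
        rw [Finset.sum_add_distrib, Finset.mul_sum, Finset.mul_sum]
    _ ≤ Real.exp ε * ∑ a ∈ S, seqProb L f' a
          + Real.exp (-(l * ε)) * Real.exp (N * (d ^ 2 * (l * (1 + l)) / 2)) := by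
        gcongr
        refine le_trans ?_ hmom
        exact Finset.sum_le_sum_of_subset_of_nonneg (Finset.subset_univ S)
          fun a _ _ => Finset.prod_nonneg fun t _ => hw0 _ _ _
    _ = _ := by rw [← Real.exp_add, add_comm]; ring_nf

/-- The privacy of EXP3 when a single gain function changes by at most `d`. -/
theorem exp3_sum_seqProb_le {K : ℕ} [NeZero K] (γ : Set.Icc (0 : ℝ) 1) (hγ : 0 < γ.1)
    {g g' : ℕ → Fin K → ℝ} {d l ε : ℝ} {N b : ℕ} (hd : 0 < d) (hl : 0 ≤ l)
    (hg : ∀ s i, g s i ∈ Set.Icc (0 : ℝ) 1)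
    (hne : ∀ s, s + 1 < N → s ≠ b → g s = g' s)
    (hb : ∀ s, s + 1 < N → ∀ i, |g s i - g' s i| ≤ d) (S : Finset (Fin N → Fin K)) :
    ∑ a ∈ S, seqProb (exp3 γ) (oblivious g) a
      ≤ Real.exp (N * (d ^ 2 * (l * (1 + l)) / 2) - l * ε)
        + Real.exp ε * ∑ a ∈ S, seqProb (exp3 γ) (oblivious g') a := by
  refine sum_seqProb_le_of_ratio _ _ _ hd hl (fun n h i => exp3Mix_pos hγ γ.2.2 _ i)
    (fun n hn a i => ?_) S
  have hK : (0 : ℝ) < K := cast_pos_of_neZero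
  have hst := exp3Est_stable hγ γ.2.2 hd.le b n (hist (oblivious g) a) (hist (oblivious g') a)
    (fun r => rfl) (fun r => hg _ _)
    (fun r hr => congrFun (hne r (by omega) hr) _) (fun r => hb r (by omega) _)
  -- The amplification `K / γ` of the estimates cancels the learning rate, so the privacy loss per
  -- draw does not depend on `γ`.
  have hD : γ.1 / K * (d * (K / γ.1)) = d := by field_simp
  have hD0 : 0 ≤ d * (K / γ.1) := by positivity
  rcases hst with h | h
  · have := exp3Mix_le_of_mem_Icc γ.2.1 γ.2.2 hD0 h i
    rw [hD] at this
    exact this.symm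
  · have := exp3Mix_le_of_mem_Icc γ.2.1 γ.2.2 hD0 h i
    rw [hD] at this
    exact this

/-! ### Reduction of the mini-batch loop to its base algorithm -/

theorem div_lt_blocks {τ n : ℕ} {t : ℕ} (h : t < n) : t / τ < (n - 1) / τ + 1 :=
  Nat.lt_succ_of_le (Nat.div_le_div_right (by omega))

theorem mul_lt_of_lt_blocks {τ n b : ℕ} (hτ : 0 < τ) (hn : 0 < n) (h : b < (n - 1) / τ + 1) :
    b * τ < n := by
  have := (Nat.le_div_iff_mul_le hτ).1 (Nat.le_of_lt_succ h)
  omega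

theorem div_lt_succ_of_lt {τ b r : ℕ} {s : Fin τ} (h : r < b * τ + s + 1) : r / τ < b + 1 := by
  have := s.isLt
  rw [Nat.div_lt_iff_lt_mul (by omega)]
  rw [Nat.add_mul]
  omega

/-- The arms played in `n` rounds when the arm `z b` is played throughout the interval `b`. -/
def expand {K : ℕ} (τ : ℕ) {n : ℕ} (z : Fin ((n - 1) / τ + 1) → Fin K) : Fin n → Fin K :=
  fun t => z ⟨t / τ, div_lt_blocks t.isLt⟩

/-- The adversary that grants in each round the average of the gains that `f` grants in an interval
of `τ` rounds in which an arm is repeated. -/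
noncomputable def batchAdv {K : ℕ} (τ : ℕ) (f : Adversary K) : Adversary K :=
  fun b z => (∑ s : Fin τ, f (b * τ + s) fun r => z ⟨r / τ, div_lt_succ_of_lt r.isLt⟩) / τ

theorem algorithm_congr {K : ℕ} (L : Algorithm K) {n n' : ℕ} (e : n = n') {h : Fin n → Fin K × ℝ}
    {h' : Fin n' → Fin K × ℝ} (hh : ∀ r : Fin n', h (Fin.cast e.symm r) = h' r) :
    L n h = L n' h' := by
  subst e
  congr 1
  funext r
  exact hh r

section batch

variable {K τ n : ℕ}

theorem miniBatch_of_mod_ne {L : Algorithm K} {h : Fin n → Fin K × ℝ} (hn : n % τ ≠ 0) (i : Fin K) :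
    (miniBatch τ L n h).1 i = if i = (h ⟨n / τ * τ, block_start_lt hn⟩).1 then 1 else 0 := by
  unfold miniBatch
  rw [dif_neg hn]
  exact Pi.single_apply _ _ _

theorem miniBatch_of_mod_eq {L : Algorithm K} {h : Fin n → Fin K × ℝ} (hn : n % τ = 0) :
    miniBatch τ L n h = L (n / τ) (batchHistory τ n h) := by
  unfold miniBatch
  rw [dif_pos hn]

/-- Rounds inside an interval contribute the factor 1, and the first round of an interval
contributes the factor of `L`. An incomplete last interval is never fed back, so its truncation does
not matter. -/
theorem seqProb_miniBatch_expand (hτ : 0 < τ) (hn : 0 < n) (L : Algorithm K) (f : Adversary K)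
    (z : Fin ((n - 1) / τ + 1) → Fin K) :
    seqProb (miniBatch τ L) f (expand τ z) = seqProb L (batchAdv τ f) z := by
  symm
  unfold seqProb
  refine Fintype.prod_of_injective
    (fun b : Fin ((n - 1) / τ + 1) => (⟨b * τ, mul_lt_of_lt_blocks hτ hn b.isLt⟩ : Fin n)) ?_ _ _
    (fun t ht => ?_) (fun b => ?_)
  · intro b b' hbb
    exact Fin.ext (Nat.eq_of_mul_eq_mul_right hτ (Fin.mk.inj_iff.1 hbb))
  · have hmod : (t : ℕ) % τ ≠ 0 := fun h0 =>
      ht ⟨⟨t / τ, div_lt_blocks t.isLt⟩, Fin.ext (Nat.div_mul_cancel (Nat.dvd_of_mod_eq_zero h0))⟩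
    rw [miniBatch_of_mod_ne hmod, if_pos]
    simp only [historyBefore, expand]
    congr 1
    exact Fin.ext (Nat.mul_div_cancel _ hτ).symm
  · have hmod : ((b : ℕ) * τ) % τ = 0 := Nat.mul_mod_left _ _
    have hdiv : (b : ℕ) * τ / τ = b := Nat.mul_div_cancel _ hτ
    simp only []
    rw [miniBatch_of_mod_eq hmod]
    have h1 : expand τ z ⟨b * τ, mul_lt_of_lt_blocks hτ hn b.isLt⟩ = z b :=
      congrArg z (Fin.ext hdiv)
    rw [h1]
    refine congrArg (fun q : stdSimplex ℝ (Fin K) => q.1 (z b))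
      (algorithm_congr L hdiv fun r => ?_).symm
    refine Prod.ext ?_ rfl
    simp only [batchHistory, historyBefore, expand]
    refine congrArg z (Fin.ext ?_)
    simp [Nat.mul_div_cancel _ hτ]

theorem expand_injective (hτ : 0 < τ) (hn : 0 < n) :
    Function.Injective (expand (K := K) τ (n := n)) := by
  intro z z' h
  funext b
  have h1 := congrFun h ⟨b * τ, mul_lt_of_lt_blocks hτ hn b.isLt⟩
  have h2 : (⟨(b : ℕ) * τ / τ, div_lt_blocks (mul_lt_of_lt_blocks hτ hn b.isLt)⟩ :
      Fin ((n - 1) / τ + 1)) = b := Fin.ext (Nat.mul_div_cancel _ hτ)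
  simpa only [expand, h2] using h1

/-- A sequence of nonzero probability repeats in every round the arm that opened the interval. -/
theorem seqProb_miniBatch_of_notMem_range (hτ : 0 < τ) (hn : 0 < n) (L : Algorithm K)
    (f : Adversary K) (a : Fin n → Fin K) (ha : a ∉ Set.range (expand (K := K) τ (n := n))) :
    seqProb (miniBatch τ L) f a = 0 := by
  by_contra hne
  refine ha ⟨fun b => a ⟨b * τ, mul_lt_of_lt_blocks hτ hn b.isLt⟩, funext fun t => ?_⟩
  simp only [expand]
  by_cases hmod : (t : ℕ) % τ = 0
  · exact congrArg a (Fin.ext (Nat.div_mul_cancel (Nat.dvd_of_mod_eq_zero hmod)))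
  · have h1 := Finset.prod_ne_zero_iff.1 hne t (Finset.mem_univ _)
    rw [miniBatch_of_mod_ne hmod] at h1
    exact (ite_ne_right_iff.1 h1).1.symm

/-- Running `L` in a mini-batch loop against `f` amounts to running `L` against `batchAdv τ f`. -/
theorem sum_seqProb_miniBatch (hτ : 0 < τ) (hn : 0 < n) (L : Algorithm K) (f : Adversary K)
    (F : (Fin n → Fin K) → ℝ) :
    ∑ a, seqProb (miniBatch τ L) f a * F a
      = ∑ z, seqProb L (batchAdv τ f) z * F (expand τ z) := by
  symm
  refine Fintype.sum_of_injective _ (expand_injective hτ hn) _ _ (fun a ha => ?_) fun z => ?_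
  · rw [seqProb_miniBatch_of_notMem_range hτ hn L f a ha, zero_mul]
  · rw [seqProb_miniBatch_expand hτ hn]

theorem sum_mem_seqProb_miniBatch (hτ : 0 < τ) (hn : 0 < n) (L : Algorithm K) (f : Adversary K)
    (S : Finset (Fin n → Fin K)) :
    ∑ a ∈ S, seqProb (miniBatch τ L) f a
      = ∑ z with expand τ z ∈ S, seqProb L (batchAdv τ f) z := by
  have h := sum_seqProb_miniBatch hτ hn L f fun a => if a ∈ S then 1 else 0
  simp only [mul_ite, mul_one, mul_zero] at h
  rw [Finset.sum_filter, ← h, Finset.sum_ite_mem, Finset.univ_inter]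

theorem batchAdv_oblivious (hτ : 0 < τ) (g : ℕ → Fin K → ℝ) :
    batchAdv τ (oblivious g)
      = oblivious fun b i => (∑ s : Fin τ, g (b * τ + s) i) / τ := by
  funext b z
  simp only [batchAdv, oblivious]
  congr 1
  refine Finset.sum_congr rfl fun s _ => congrArg _ (congrArg z (Fin.ext ?_))
  simp only [Fin.val_last]
  rw [mul_comm, Nat.mul_add_div hτ, Nat.div_eq_of_lt s.isLt, add_zero]

theorem sum_div_mem_Icc (hτ : 0 < τ) {x : Fin τ → ℝ} (hx : ∀ s, x s ∈ Set.Icc (0 : ℝ) 1) :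
    (∑ s, x s) / τ ∈ Set.Icc (0 : ℝ) 1 := by
  have hτ' : (0 : ℝ) < τ := by exact_mod_cast hτ
  refine ⟨div_nonneg (Finset.sum_nonneg fun s _ => (hx s).1) hτ'.le, ?_⟩
  rw [div_le_one hτ']
  calc ∑ s, x s ≤ ∑ _s : Fin τ, (1 : ℝ) := Finset.sum_le_sum fun s _ => (hx s).2
    _ = τ := by simp

/-- The privacy of EXP3 in a mini-batch loop. -/
theorem exp3_miniBatch_sum_seqProb_le [NeZero K] (hτ : 0 < τ) (hn : 0 < n) (γ : Set.Icc (0 : ℝ) 1)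
    (hγ : 0 < γ.1) {g g' : ℕ → Fin K → ℝ} {l ε : ℝ} (hl : 0 ≤ l)
    (hg : ∀ s i, g s i ∈ Set.Icc (0 : ℝ) 1) (hg' : ∀ s i, g' s i ∈ Set.Icc (0 : ℝ) 1)
    {s₀ : ℕ} (hs : ∀ s, s + 1 < n → s ≠ s₀ → g s = g' s) (S : Finset (Fin n → Fin K)) :
    ∑ a ∈ S, seqProb (miniBatch τ (exp3 γ)) (oblivious g) a
      ≤ Real.exp (((n - 1) / τ + 1 : ℕ) * ((1 / (τ : ℝ)) ^ 2 * (l * (1 + l)) / 2) - l * ε)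
        + Real.exp ε * ∑ a ∈ S, seqProb (miniBatch τ (exp3 γ)) (oblivious g') a := by
  have hτ' : (0 : ℝ) < τ := by exact_mod_cast hτ
  rw [sum_mem_seqProb_miniBatch hτ hn, sum_mem_seqProb_miniBatch hτ hn, batchAdv_oblivious hτ,
    batchAdv_oblivious hτ]
  -- Only intervals before the last one influence a draw, and all their rounds are among the first
  -- `n - 1`.
  have hlt : ∀ b, b + 1 < (n - 1) / τ + 1 → ∀ s : Fin τ, b * τ + s + 1 < n := by
    intro b hb s
    have h1 := mul_lt_of_lt_blocks hτ hn hb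
    have := s.isLt
    rw [Nat.add_mul] at h1
    omega
  have hblock : ∀ b, ∀ s : Fin τ, b * τ + s = s₀ → b = s₀ / τ ∧ (s : ℕ) = s₀ % τ := by
    intro b s h
    subst h
    constructor
    · rw [mul_comm, Nat.mul_add_div hτ, Nat.div_eq_of_lt s.isLt, add_zero]
    · rw [Nat.mul_add_mod_of_lt s.isLt]
  refine exp3_sum_seqProb_le γ hγ (b := s₀ / τ) (by positivity) hl
    (fun b i => sum_div_mem_Icc hτ fun s => hg _ _) (fun b hb hbne => ?_) (fun b hb i => ?_) _
  · funext i
    congr 1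
    exact Finset.sum_congr rfl fun s _ => congrFun (hs _ (hlt b hb s)
      fun h => hbne (hblock b s h).1) i
  · rw [← sub_div, ← Finset.sum_sub_distrib, abs_div, abs_of_pos hτ']
    gcongr
    -- At most one gain in the interval differs, so the average moves by at most `1 / τ`.
    rw [Finset.sum_eq_single (⟨s₀ % τ, Nat.mod_lt _ hτ⟩ : Fin τ)]
    · have h1 := hg (b * τ + s₀ % τ) i
      have h2 := hg' (b * τ + s₀ % τ) i
      rw [abs_le]
      constructor <;> linarith [h1.1, h1.2, h2.1, h2.2]
    · intro s _ hne
      rw [sub_eq_zero]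
      exact congrFun (hs _ (hlt b hb s) fun h => hne (Fin.ext (hblock b s h).2)) i
    · exact fun h => absurd (Finset.mem_univ _) h

end batch

/-! ### Expected gain of EXP3 against adaptive adversaries -/

theorem sum_seqProb_mul_le {K : ℕ} {L : Algorithm K} {f : Adversary K} {n : ℕ}
    {F : (Fin n → Fin K) → ℝ} {c : ℝ}
    (h : ∀ a, F a ≤ c) : ∑ a, seqProb L f a * F a ≤ c := by
  calc ∑ a, seqProb L f a * F a ≤ ∑ a, seqProb L f a * c :=
        Finset.sum_le_sum fun a _ => mul_le_mul_of_nonneg_left (h a) (seqProb_nonneg L f a)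
    _ = c := by rw [← Finset.sum_mul, sum_seqProb, one_mul]

theorem le_sum_seqProb_mul {K : ℕ} {L : Algorithm K} {f : Adversary K} {n : ℕ}
    {F : (Fin n → Fin K) → ℝ} {c : ℝ}
    (h : ∀ a, c ≤ F a) : c ≤ ∑ a, seqProb L f a * F a := by
  calc c = ∑ a, seqProb L f a * c := by rw [← Finset.sum_mul, sum_seqProb, one_mul]
    _ ≤ _ := Finset.sum_le_sum fun a _ => mul_le_mul_of_nonneg_left (h a) (seqProb_nonneg L f a)

section exp3

variable {K : ℕ} [NeZero K] {γ : ℝ}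

/-- One step of the analysis of the exponential weights. -/
theorem log_sum_exp_step (h0 : 0 < γ) (h1 : γ ≤ 1) (G : Fin K → ℝ) (i : Fin K) {x : ℝ}
    (hx0 : 0 ≤ x) (hx1 : x ≤ 1) :
    (1 - γ) * (Real.log (∑ j, Real.exp (γ / K * (G j + if i = j then x / exp3Mix γ G j else 0)))
        - Real.log (∑ j, Real.exp (γ / K * G j)))
      ≤ γ / K * x + (Real.exp 1 - 2) * (γ / K) ^ 2 * (x / exp3Mix γ G i) := by
  have hK : (0 : ℝ) < K := cast_pos_of_neZero
  have hp := exp3Mix_pos h0 h1 G i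
  have hpη := le_exp3Mix h1 G i
  have hη : 0 < γ / K := div_pos h0 hK
  have hW := sum_exp_pos (fun j => γ / K * G j)
  have he2 : 0 < Real.exp 1 - 2 := by linarith [Real.exp_one_gt_d9]
  set η := γ / (K : ℝ) with hηd
  set W := ∑ j, Real.exp (η * G j) with hWd
  set p := exp3Mix γ G i with hpd
  set y := η * (x / p) with hy
  have hy0 : 0 ≤ y := by positivity
  have hy1 : y ≤ 1 := by
    rw [hy, mul_div_assoc', div_le_one hp]
    nlinarith
  have hsum : ∑ j, Real.exp (η * (G j + if i = j then x / exp3Mix γ G j else 0))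
      = W + Real.exp (η * G i) * (Real.exp y - 1) := by
    have : ∀ j, Real.exp (η * (G j + if i = j then x / exp3Mix γ G j else 0))
        = Real.exp (η * G j) + if i = j then Real.exp (η * G i) * (Real.exp y - 1) else 0 := by
      intro j
      split_ifs with hij
      · subst hij
        rw [mul_add, Real.exp_add]
        ring
      · simp
    rw [Finset.sum_congr rfl fun j _ => this j, Finset.sum_add_distrib, Finset.sum_ite_eq]
    simp only [Finset.mem_univ, if_true, hWd]
  set v := Real.exp (η * G i) / W with hv
  have hv0 : 0 < v := div_pos (Real.exp_pos _) hW
  have hey : 0 ≤ Real.exp y - 1 := by linarith [Real.add_one_le_exp y]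
  have hlog : Real.log (W + Real.exp (η * G i) * (Real.exp y - 1)) - Real.log W
      ≤ v * (Real.exp y - 1) := by
    rw [← Real.log_div (by positivity) hW.ne']
    refine (Real.log_le_sub_one_of_pos (by positivity)).trans_eq ?_
    rw [hv]
    field_simp
    ring
  -- The potential carries the factor `1 - γ` so that `v` can be replaced by `p` without a division,
  -- which also covers `γ = 1`.
  have hvp : (1 - γ) * v ≤ p := by
    have : p = (1 - γ) * v + η := rfl
    linarith
  rw [hsum]
  calc _ ≤ (1 - γ) * (v * (Real.exp y - 1)) :=
        mul_le_mul_of_nonneg_left hlog (sub_nonneg.2 h1)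
    _ = ((1 - γ) * v) * (Real.exp y - 1) := by ring
    _ ≤ p * (y + (Real.exp 1 - 2) * y ^ 2) := by
        refine mul_le_mul hvp ?_ hey hp.le
        linarith [exp_le_one_add_add_sq hy0 hy1]
    _ = η * x + (Real.exp 1 - 2) * η ^ 2 * (x * (x / p)) := by
        rw [hy]
        field_simp
    _ ≤ η * x + (Real.exp 1 - 2) * η ^ 2 * (1 * (x / p)) := by gcongr
    _ = _ := by rw [one_mul]

theorem log_sum_exp_exp3Est_le (h0 : 0 < γ) (h1 : γ ≤ 1) (n : ℕ) (h : Fin n → Fin K × ℝ)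
    (hx : ∀ r, (h r).2 ∈ Set.Icc (0 : ℝ) 1) :
    (1 - γ) * (Real.log (∑ j, Real.exp (γ / K * exp3Est γ n h j)) - Real.log K)
      ≤ γ / K * ∑ r, (h r).2 + (Real.exp 1 - 2) * (γ / K) ^ 2 * ∑ j, exp3Est γ n h j := by
  induction n with
  | zero => simp [exp3Est]
  | succ n ih =>
    have h2 := ih (fun r => h r.castSucc) fun r => hx _
    have h3 := log_sum_exp_step h0 h1 (exp3Est γ n fun r => h r.castSucc) (h (Fin.last n)).1
      (hx (Fin.last n)).1 (hx (Fin.last n)).2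
    rw [Fin.sum_univ_castSucc]
    simp only [exp3Est]
    rw [Finset.sum_add_distrib, Finset.sum_ite_eq]
    simp only [Finset.mem_univ, if_true]
    nlinarith

/-- The single term of arm `i` bounds the potential from below; the result is then divided by `γ /
K`. -/
theorem exp3Est_le (h0 : 0 < γ) (h1 : γ ≤ 1) (n : ℕ) (h : Fin n → Fin K × ℝ)
    (hx : ∀ r, (h r).2 ∈ Set.Icc (0 : ℝ) 1) (i : Fin K) :
    (1 - γ) * exp3Est γ n h i - K * Real.log K / γ
      ≤ ∑ r, (h r).2 + (Real.exp 1 - 2) * (γ / K) * ∑ j, exp3Est γ n h j := by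
  have hK : (0 : ℝ) < K := cast_pos_of_neZero
  have hη : 0 < γ / K := div_pos h0 hK
  have h2 := log_sum_exp_exp3Est_le h0 h1 n h hx
  have h3 : γ / K * exp3Est γ n h i ≤ Real.log (∑ j, Real.exp (γ / K * exp3Est γ n h j)) := by
    rw [Real.le_log_iff_exp_le (sum_exp_pos _)]
    exact Finset.single_le_sum (f := fun j => Real.exp (γ / K * exp3Est γ n h j))
      (fun j _ => (Real.exp_pos _).le) (Finset.mem_univ i)
  have hlogK : 0 ≤ Real.log K := Real.log_natCast_nonneg K
  have h4 : (1 - γ) * (γ / K * exp3Est γ n h i) - Real.log K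
      ≤ γ / K * ∑ r, (h r).2 + (Real.exp 1 - 2) * (γ / K) ^ 2 * ∑ j, exp3Est γ n h j := by
    have h5 := mul_le_mul_of_nonneg_left h3 (sub_nonneg.2 h1)
    have h6 := mul_nonneg h0.le hlogK
    linarith
  refine le_of_mul_le_mul_left ?_ hη
  have e : γ / K * (K * Real.log K / γ) = Real.log K := by field_simp
  rw [mul_sub, e]
  linarith

variable {f : Adversary K}

/-- Importance weighting is unbiased: the probability of drawing `i` cancels, which leaves the gain
that `i` would have earned after the same past. -/
theorem sum_seqProb_exp3Est_succ (γ : Set.Icc (0 : ℝ) 1) (hγ : 0 < γ.1) (f : Adversary K) (n : ℕ)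
    (i : Fin K) :
    ∑ a : Fin (n + 1) → Fin K, seqProb (exp3 γ) f a * exp3Est γ.1 (n + 1) (hist f a) i
      = ∑ a : Fin n → Fin K, seqProb (exp3 γ) f a * exp3Est γ.1 n (hist f a) i
        + ∑ a : Fin n → Fin K, seqProb (exp3 γ) f a * f n (Fin.snoc a i) := by
  rw [sum_seqProb_succ, ← Finset.sum_add_distrib]
  refine Finset.sum_congr rfl fun a _ => ?_
  rw [← mul_add]
  congr 1
  simp only [exp3Est, hist_snoc_castSucc, hist_snoc_last, mul_add]
  rw [Finset.sum_add_distrib, ← Finset.sum_mul, (exp3 γ n _).2.2, one_mul]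
  congr 1
  simp only [mul_ite, mul_zero]
  rw [Finset.sum_ite_eq']
  simp only [Finset.mem_univ, if_true]
  exact mul_div_cancel₀ _ (exp3Mix_pos hγ γ.2.2 _ i).ne'

theorem sum_seqProb_exp3Est_le (γ : Set.Icc (0 : ℝ) 1) (hγ : 0 < γ.1)
    (hf : ∀ n a, f n a ∈ Set.Icc (0 : ℝ) 1) (n : ℕ) (i : Fin K) :
    ∑ a : Fin n → Fin K, seqProb (exp3 γ) f a * exp3Est γ.1 n (hist f a) i ≤ n := by
  induction n with
  | zero => simp [exp3Est]
  | succ n ih =>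
    rw [sum_seqProb_exp3Est_succ γ hγ]
    push_cast
    exact add_le_add ih (sum_seqProb_mul_le fun a => (hf _ _).2)

theorem le_sum_seqProb_exp3Est (γ : Set.Icc (0 : ℝ) 1) (hγ : 0 < γ.1) (n : ℕ) (i : Fin K)
    {c : ℕ → ℝ} (hc : ∀ n, ∀ a : Fin n → Fin K, c n ≤ f n (Fin.snoc a i)) :
    ∑ r ∈ Finset.range n, c r
      ≤ ∑ a : Fin n → Fin K, seqProb (exp3 γ) f a * exp3Est γ.1 n (hist f a) i := by
  induction n with
  | zero => simp [exp3Est]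
  | succ n ih =>
    rw [sum_seqProb_exp3Est_succ γ hγ, Finset.sum_range_succ]
    exact add_le_add ih (le_sum_seqProb_mul fun a => hc n a)

/-- The performance of EXP3 against an adaptive adversary that grants the arm `i` at least the gain
`c n` in round `n`, whatever happened before. -/
theorem exp3_gain_ge (γ : Set.Icc (0 : ℝ) 1) (hγ : 0 < γ.1)
    (hf : ∀ n a, f n a ∈ Set.Icc (0 : ℝ) 1) (n : ℕ) (i : Fin K)
    {c : ℕ → ℝ} (hc : ∀ n, ∀ a : Fin n → Fin K, c n ≤ f n (Fin.snoc a i)) :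
    ∑ r ∈ Finset.range n, c r - (Real.exp 1 - 1) * γ.1 * n - K * Real.log K / γ.1
      ≤ ∑ a : Fin n → Fin K, seqProb (exp3 γ) f a * ∑ r, gainAt f a r := by
  have hK : (0 : ℝ) < K := cast_pos_of_neZero
  have he2 : 0 < Real.exp 1 - 2 := by linarith [Real.exp_one_gt_d9]
  have h1 : 0 ≤ ∑ a : Fin n → Fin K, seqProb (exp3 γ) f a *
      (∑ r, gainAt f a r + (Real.exp 1 - 2) * (γ.1 / K) * ∑ j, exp3Est γ.1 n (hist f a) j
        - ((1 - γ.1) * exp3Est γ.1 n (hist f a) i - K * Real.log K / γ.1)) :=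
    Finset.sum_nonneg fun a _ => mul_nonneg (seqProb_nonneg _ _ _)
      (sub_nonneg.2 (exp3Est_le hγ γ.2.2 n (hist f a) (fun r => hf _ _) i))
  have h2 : ∑ a : Fin n → Fin K, seqProb (exp3 γ) f a *
      (∑ r, gainAt f a r + (Real.exp 1 - 2) * (γ.1 / K) * ∑ j, exp3Est γ.1 n (hist f a) j
        - ((1 - γ.1) * exp3Est γ.1 n (hist f a) i - K * Real.log K / γ.1))
      = ∑ a : Fin n → Fin K, seqProb (exp3 γ) f a * ∑ r, gainAt f a r
        + (Real.exp 1 - 2) * (γ.1 / K) *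
          ∑ j, ∑ a : Fin n → Fin K, seqProb (exp3 γ) f a * exp3Est γ.1 n (hist f a) j
        - (1 - γ.1) * ∑ a : Fin n → Fin K, seqProb (exp3 γ) f a * exp3Est γ.1 n (hist f a) i
        + K * Real.log K / γ.1 * ∑ a : Fin n → Fin K, seqProb (exp3 γ) f a := by
    rw [Finset.sum_comm]
    simp only [Finset.mul_sum, ← Finset.sum_add_distrib, ← Finset.sum_sub_distrib]
    refine Finset.sum_congr rfl fun a _ => ?_
    rw [mul_sub, mul_add, Finset.mul_sum, Finset.mul_sum]
    have : ∀ j, seqProb (exp3 γ) f a * ((Real.exp 1 - 2) * (γ.1 / K) * exp3Est γ.1 n (hist f a) j)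
        = (Real.exp 1 - 2) * (γ.1 / K) * (seqProb (exp3 γ) f a * exp3Est γ.1 n (hist f a) j) :=
      fun j => by ring
    simp only [this]
    ring
  rw [h2, sum_seqProb] at h1
  have h3 : ∑ j, ∑ a : Fin n → Fin K, seqProb (exp3 γ) f a * exp3Est γ.1 n (hist f a) j ≤ K * n := by
    calc _ ≤ ∑ _j : Fin K, (n : ℝ) :=
          Finset.sum_le_sum fun j _ => sum_seqProb_exp3Est_le γ hγ hf n j
      _ = K * n := by simp
  have h4 := le_sum_seqProb_exp3Est γ hγ n i hc
  -- The constant `e - 1` is made of `e - 2` from the second-order term and 1 from the factor `1 -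
  -- γ` before the estimate of arm `i`.
  have h5 := mul_le_mul_of_nonneg_left (sum_seqProb_exp3Est_le γ hγ hf n i) hγ.le
  have h6 := mul_le_mul_of_nonneg_left h3 (mul_nonneg he2.le (div_nonneg hγ.le hK.le))
  have e : (Real.exp 1 - 2) * (γ.1 / K) * (K * n) = (Real.exp 1 - 2) * γ.1 * n := by
    field_simp
  rw [e] at h6
  linarith

end exp3

/-! ### Regret under switching costs for general parameters -/

section switching

variable {K : ℕ} {g : ℕ → Fin K → ℝ}

theorem switchingCosts_mem_Icc (hg : ∀ t i, g t i ∈ Set.Icc (0 : ℝ) 1) (t : ℕ)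
    (a : Fin (t + 1) → Fin K) : switchingCosts g t a ∈ Set.Icc (0 : ℝ) 1 := by
  cases t with
  | zero => exact hg _ _
  | succ t =>
    simp only [switchingCosts]
    split_ifs
    · exact hg _ _
    · exact ⟨le_rfl, zero_le_one⟩

/-- The condition `t ≤ r + 1` selects the rounds `t - 1` and `t`, and for `t = 0` the only round. -/
theorem switchingCosts_of_eq {t : ℕ} {a : Fin (t + 1) → Fin K} {i : Fin K}
    (h : ∀ r : Fin (t + 1), t ≤ r + 1 → a r = i) : switchingCosts g t a = g t i := by
  cases t with
  | zero =>
    have := h 0 (Nat.zero_le _)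
    simp only [switchingCosts]
    rw [this]
  | succ t =>
    have h1 := h (Fin.last (t + 1)) (by simp)
    have h2 := h (Fin.last t).castSucc (by simp)
    simp only [switchingCosts]
    rw [if_pos (h1.trans h2.symm), h1]

theorem gainAt_switchingCosts_const {T : ℕ} (i : Fin K) (t : Fin T) :
    gainAt (switchingCosts g) (fun _ => i) t = g t i :=
  switchingCosts_of_eq fun _ _ => rfl

/-- Only the first round of an interval can be a switch, and it loses at most one unit of gain. -/
theorem le_batchAdv_switchingCosts (hg : ∀ t i, g t i ∈ Set.Icc (0 : ℝ) 1) {τ : ℕ} (b : ℕ)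
    (z : Fin b → Fin K) (i : Fin K) :
    (∑ s ∈ Finset.range τ, g (b * τ + s) i - 1) / τ
      ≤ batchAdv τ (switchingCosts g) b (Fin.snoc z i) := by
  have hz : ∀ (r : ℕ) (hr : r < b + 1), b ≤ r → (Fin.snoc z i : Fin (b + 1) → Fin K) ⟨r, hr⟩ = i :=
    fun r hr h => by
      have : (⟨r, hr⟩ : Fin (b + 1)) = Fin.last b := Fin.ext (by simp; omega)
      rw [this, Fin.snoc_last]
  unfold batchAdv
  gcongr
  rw [← Fin.sum_univ_eq_sum_range (fun s => g (b * τ + s) i), sub_le_iff_le_add]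
  have hone : ∑ s : Fin τ, (if (s : ℕ) = 0 then (1 : ℝ) else 0) ≤ 1 := by
    rw [Fin.sum_univ_eq_sum_range (fun s => if s = 0 then (1 : ℝ) else 0), Finset.sum_ite_eq']
    split_ifs <;> norm_num
  refine le_trans ?_ (add_le_add_right hone _)
  rw [← Finset.sum_add_distrib]
  refine Finset.sum_le_sum fun s _ => ?_
  split_ifs with hs
  · have h1 := (switchingCosts_mem_Icc hg (b * τ + s) fun r =>
      (Fin.snoc z i : Fin (b + 1) → Fin K) ⟨r / τ, div_lt_succ_of_lt r.isLt⟩).1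
    linarith [(hg (b * τ + s) i).2]
  · rw [add_zero]
    refine (switchingCosts_of_eq fun r hr => hz _ _ ?_).ge
    rw [Nat.le_div_iff_mul_le (Nat.pos_of_ne_zero fun h => by have := s.isLt; omega)]
    omega

theorem sum_range_mul_eq {M : Type*} [AddCommMonoid M] (F : ℕ → M) (m τ : ℕ) :
    ∑ t ∈ Finset.range (m * τ), F t
      = ∑ b ∈ Finset.range m, ∑ s ∈ Finset.range τ, F (b * τ + s) := by
  induction m with
  | zero => simp
  | succ m ih => rw [Nat.add_mul, Nat.one_mul, Finset.sum_range_add, ih, Finset.sum_range_succ]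

/-- Complete intervals contribute exactly `τ` times their average; the nonnegative gains of an
incomplete one are dropped. -/
theorem le_sum_gainAt_expand {f : Adversary K} (hf : ∀ t a, f t a ∈ Set.Icc (0 : ℝ) 1) {τ n : ℕ}
    (hτ : 0 < τ) (h : n / τ ≤ (n - 1) / τ + 1) (z : Fin ((n - 1) / τ + 1) → Fin K) :
    τ * ∑ b, gainAt (batchAdv τ f) (fun r : Fin (n / τ) => z (Fin.castLE h r)) b
      ≤ ∑ t, gainAt f (expand τ z) t := by
  have hτ' : (τ : ℝ) ≠ 0 := by exact_mod_cast hτ.ne'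
  set G : ℕ → ℝ := fun t => if h : t < n then gainAt f (expand τ z) ⟨t, h⟩ else 0 with hG
  have hGv : ∀ (t : ℕ) (ht : t < n), G t = gainAt f (expand τ z) ⟨t, ht⟩ := fun t ht => dif_pos ht
  have h1 : ∑ t, gainAt f (expand τ z) t = ∑ t ∈ Finset.range n, G t := by
    rw [← Fin.sum_univ_eq_sum_range]
    exact Finset.sum_congr rfl fun t _ => (hGv t t.isLt).symm
  rw [h1]
  have h2 : ∑ t ∈ Finset.range (n / τ * τ), G t ≤ ∑ t ∈ Finset.range n, G t := by
    refine Finset.sum_le_sum_of_subset_of_nonneg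
      (Finset.range_subset_range.2 (Nat.div_mul_le_self n τ)) fun t ht _ => ?_
    rw [hGv t (Finset.mem_range.1 ht)]
    exact (hf _ _).1
  refine le_trans (le_of_eq ?_) h2
  rw [sum_range_mul_eq, ← Fin.sum_univ_eq_sum_range, Finset.mul_sum]
  refine Finset.sum_congr rfl fun b _ => ?_
  have h3 : gainAt (batchAdv τ f) (fun r : Fin (n / τ) => z (Fin.castLE h r)) b
      = (∑ s : Fin τ, gainAt f (expand τ z) ⟨b * τ + s, block_lt b s⟩) / τ := rfl
  rw [h3, mul_div_cancel₀ _ hτ', ← Fin.sum_univ_eq_sum_range]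
  exact Finset.sum_congr rfl fun s _ => (hGv _ _).symm

theorem regret_switchingCosts_le (hg : ∀ t i, g t i ∈ Set.Icc (0 : ℝ) 1) [NeZero K] {T : ℕ}
    (a : Fin T → Fin K) : regret (switchingCosts g) a ≤ T := by
  have h1 : (⨆ i : Fin K, ∑ t : Fin T, gainAt (switchingCosts g) (fun _ => i) t) ≤ T := by
    refine ciSup_le fun i => ?_
    calc _ ≤ ∑ _t : Fin T, (1 : ℝ) :=
          Finset.sum_le_sum fun t _ => (switchingCosts_mem_Icc hg _ _).2
      _ = T := by simp
  have h2 : 0 ≤ ∑ t : Fin T, gainAt (switchingCosts g) a t :=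
    Finset.sum_nonneg fun t _ => (switchingCosts_mem_Icc hg _ _).1
  unfold regret
  linarith

/-- The three terms are the possible switch at the start of each complete interval, `τ` times the
EXP3 regret on the averages, and the best arm's gain in the incomplete interval. -/
theorem agentRegret_miniBatch_exp3_le [NeZero K] (hg : ∀ t i, g t i ∈ Set.Icc (0 : ℝ) 1)
    {τ T : ℕ} (hτ : 0 < τ) (hT : 0 < T) (γ : Set.Icc (0 : ℝ) 1) (hγ : 0 < γ.1) :
    agentRegret (miniBatch τ (exp3 γ)) (switchingCosts g) T
      ≤ (T / τ : ℕ) + τ * ((Real.exp 1 - 1) * γ.1 * (T / τ : ℕ) + K * Real.log K / γ.1)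
        + (T % τ : ℕ) := by
  have hτ' : (τ : ℝ) ≠ 0 := by exact_mod_cast hτ.ne'
  have hτ0 : (0 : ℝ) ≤ τ := Nat.cast_nonneg τ
  have hf := switchingCosts_mem_Icc hg
  set m := T / τ with hm
  have hmN : m ≤ (T - 1) / τ + 1 := by
    rw [← Nat.add_div_right _ hτ]
    exact Nat.div_le_div_right (by omega)
  obtain ⟨i, hi⟩ := exists_eq_ciSup_of_finite
    (f := fun i : Fin K => ∑ t : Fin T, gainAt (switchingCosts g) (fun _ => i) t)
  have hbest : ∑ t : Fin T, gainAt (switchingCosts g) (fun _ => i) t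
      ≤ ∑ t ∈ Finset.range (m * τ), g t i + (T % τ : ℕ) := by
    simp only [gainAt_switchingCosts_const]
    rw [Fin.sum_univ_eq_sum_range (fun t => g t i)]
    nth_rewrite 1 [← Nat.div_add_mod' T τ]
    rw [Finset.sum_range_add]
    gcongr
    calc _ ≤ ∑ _t ∈ Finset.range (T % τ), (1 : ℝ) := Finset.sum_le_sum fun t _ => (hg _ _).2
      _ = _ := by simp
  set A : ℝ := ∑ t ∈ Finset.range (m * τ), g t i + (T % τ : ℕ) with hA
  set f' := batchAdv τ (switchingCosts g) with hf'd
  have hf' : ∀ n a, f' n a ∈ Set.Icc (0 : ℝ) 1 := fun n a => sum_div_mem_Icc hτ fun s => hf _ _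
  have hgain := exp3_gain_ge γ hγ hf' m i fun b z => le_batchAdv_switchingCosts hg (τ := τ) b z i
  have hcomp : τ * ∑ b ∈ Finset.range m, (∑ s ∈ Finset.range τ, g (b * τ + s) i - 1) / τ
      = ∑ t ∈ Finset.range (m * τ), g t i - m := by
    rw [← Finset.sum_div, mul_div_cancel₀ _ hτ', Finset.sum_sub_distrib, sum_range_mul_eq]
    simp
  have hreg : agentRegret (miniBatch τ (exp3 γ)) (switchingCosts g) T
      ≤ A - τ * ∑ z : Fin m → Fin K, seqProb (exp3 γ) f' z * ∑ b, gainAt f' z b := by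
    unfold agentRegret
    rw [sum_seqProb_miniBatch hτ hT]
    calc _ ≤ ∑ z : Fin ((T - 1) / τ + 1) → Fin K, seqProb (exp3 γ) f' z *
          (A - τ * ∑ b, gainAt f' (fun r : Fin m => z (Fin.castLE hmN r)) b) := by
          refine Finset.sum_le_sum fun z _ =>
            mul_le_mul_of_nonneg_left ?_ (seqProb_nonneg _ _ _)
          unfold regret
          rw [← hi]
          exact sub_le_sub hbest (le_sum_gainAt_expand hf hτ hmN z)
      _ = ∑ z : Fin m → Fin K, seqProb (exp3 γ) f' z * (A - τ * ∑ b, gainAt f' z b) :=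
          sum_seqProb_castLE (exp3 γ) f' hmN fun z => A - τ * ∑ b, gainAt f' z b
      _ = _ := by
          simp only [mul_sub, Finset.sum_sub_distrib]
          rw [← Finset.sum_mul, sum_seqProb, one_mul]
          congr 1
          rw [Finset.mul_sum]
          exact Finset.sum_congr rfl fun z _ => by ring
  have h2 := mul_le_mul_of_nonneg_left hgain hτ0
  rw [mul_sub, mul_sub, hcomp] at h2
  linarith

end switching

/-! ### Measurability and boundedness of the regret -/

section measurable

variable {K : ℕ} {Ω : Type*} [MeasurableSpace Ω]

theorem measurable_exp3Mix (γ : ℝ) {G : Ω → Fin K → ℝ} (hG : ∀ i, Measurable fun ω => G ω i)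
    (i : Fin K) : Measurable fun ω => exp3Mix γ (G ω) i := by
  unfold exp3Mix
  have h : ∀ i, Measurable fun ω => Real.exp (γ / K * G ω i) := fun i =>
    Real.measurable_exp.comp ((hG i).const_mul _)
  exact (((h i).div (Finset.measurable_fun_sum _ fun j _ => h j)).const_mul _).add_const _

theorem measurable_exp3Est (γ : ℝ) (n : ℕ) (a : Fin n → Fin K) {x : Ω → Fin n → ℝ}
    (hx : ∀ r, Measurable fun ω => x ω r) (i : Fin K) :
    Measurable fun ω => exp3Est γ n (fun r => (a r, x ω r)) i := by
  induction n generalizing i with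
  | zero => exact measurable_const
  | succ n ih =>
    have h := ih (fun r => a r.castSucc) (x := fun ω r => x ω r.castSucc) fun r => hx _
    simp only [exp3Est]
    refine (h i).add ?_
    split_ifs
    · exact (hx _).div (measurable_exp3Mix γ h i)
    · exact measurable_const

theorem measurable_seqProb_exp3 [NeZero K] (γ : Set.Icc (0 : ℝ) 1) {f : Ω → Adversary K}
    (hf : ∀ t a, Measurable fun ω => f ω t a) {n : ℕ} (a : Fin n → Fin K) :
    Measurable fun ω => seqProb (exp3 γ) (f ω) a :=
  Finset.measurable_fun_prod _ fun t _ =>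
    measurable_exp3Mix γ.1 (G := fun ω => exp3Est γ.1 t (historyBefore (f ω) a t))
      (fun i => measurable_exp3Est γ.1 t (fun r => a (Fin.castLE t.isLt.le r))
        (x := fun ω r => gainAt (f ω) a (Fin.castLE t.isLt.le r)) (fun _ => hf _ _) i) _

theorem measurable_regret {f : Ω → Adversary K} (hf : ∀ t a, Measurable fun ω => f ω t a)
    {n : ℕ} (a : Fin n → Fin K) : Measurable fun ω => regret (f ω) a := by
  have h : ∀ a : Fin n → Fin K, Measurable fun ω => ∑ t, gainAt (f ω) a t := fun a =>
    Finset.measurable_fun_sum _ fun _ _ => hf _ _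
  exact (Measurable.iSup fun i => h fun _ => i).sub (h a)

theorem measurable_agentRegret_miniBatch_exp3 [NeZero K] (γ : Set.Icc (0 : ℝ) 1)
    {f : Ω → Adversary K} (hf : ∀ t a, Measurable fun ω => f ω t a) {τ T : ℕ}
    (hτ : 0 < τ) (hT : 0 < T) :
    Measurable fun ω => agentRegret (miniBatch τ (exp3 γ)) (f ω) T := by
  unfold agentRegret
  simp only [sum_seqProb_miniBatch hτ hT]
  refine Finset.measurable_fun_sum _ fun z _ => (measurable_seqProb_exp3 γ (fun b a => ?_) z).mul
    (measurable_regret hf _)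
  unfold batchAdv
  exact (Finset.measurable_fun_sum _ fun s _ => hf _ _).div_const _

end measurable

theorem measurable_switchingCosts {K : ℕ} {Ω : Type*} [MeasurableSpace Ω] {g : Ω → ℕ → Fin K → ℝ}
    (hg : ∀ t i, Measurable fun ω => g ω t i) (t : ℕ) (a : Fin (t + 1) → Fin K) :
    Measurable fun ω => switchingCosts (g ω) t a := by
  cases t with
  | zero => exact hg _ _
  | succ t =>
    simp only [switchingCosts]
    split_ifs
    · exact hg _ _
    · exact measurable_const

theorem abs_regret_switchingCosts_le {K : ℕ} [NeZero K] {g : ℕ → Fin K → ℝ}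
    (hg : ∀ t i, g t i ∈ Set.Icc (0 : ℝ) 1) {T : ℕ} (a : Fin T → Fin K) :
    |regret (switchingCosts g) a| ≤ T := by
  refine abs_le.2 ⟨?_, regret_switchingCosts_le hg a⟩
  have h1 : 0 ≤ ⨆ i : Fin K, ∑ t : Fin T, gainAt (switchingCosts g) (fun _ => i) t :=
    Real.iSup_nonneg fun i => Finset.sum_nonneg fun t _ => (switchingCosts_mem_Icc hg _ _).1
  have h2 : ∑ t : Fin T, gainAt (switchingCosts g) a t ≤ T := by
    calc _ ≤ ∑ _t : Fin T, (1 : ℝ) :=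
          Finset.sum_le_sum fun t _ => (switchingCosts_mem_Icc hg _ _).2
      _ = T := by simp
  unfold regret
  linarith

theorem abs_agentRegret_switchingCosts_le {K : ℕ} [NeZero K] (L : Algorithm K) {g : ℕ → Fin K → ℝ}
    (hg : ∀ t i, g t i ∈ Set.Icc (0 : ℝ) 1) (T : ℕ) :
    |agentRegret L (switchingCosts g) T| ≤ T :=
  abs_le.2 ⟨le_sum_seqProb_mul fun a => (abs_le.1 (abs_regret_switchingCosts_le hg a)).1,
    sum_seqProb_mul_le fun a => (abs_le.1 (abs_regret_switchingCosts_le hg a)).2⟩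

/-! ### Choice of the parameters -/

section parameters

variable {K T τ : ℕ}

theorem one_lt_mul_log (hK : 2 ≤ K) : 1 < (K : ℝ) * Real.log K := by
  have h2 : (2 : ℝ) ≤ K := by exact_mod_cast hK
  have h3 : Real.log 2 ≤ Real.log K := Real.log_le_log (by norm_num) h2
  nlinarith [Real.log_two_gt_d9]

theorem exp3Rate_pos (hK : 2 ≤ K) {N : ℝ} (hN : 0 < N) : 0 < (exp3Rate K N).1 := by
  have h := one_lt_mul_log hK
  have he : 0 < Real.exp 1 - 1 := by linarith [Real.exp_one_gt_d9]
  exact lt_min one_pos (Real.sqrt_pos.2 (div_pos (by linarith) (mul_pos he hN)))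

/-- Here `t` is the interval length and `M` the number of draws. From `n / t ^ 3 ≤ V` and `1 / t ^ 2
≤ 1 ≤ V` follows `M / t ^ 2 ≤ 2 V`, so the left side is at most `-3 V l (1 + l)`. -/
theorem privacy_exponent_le {V t n l M ε : ℝ} (hV : 1 ≤ V) (ht : 1 ≤ t) (hn : n ≤ V * t ^ 3)
    (hM : M ≤ n / t + 1) (hl : 0 ≤ l) (hε : ε = 4 * V + 4 * V * l) :
    M * ((1 / t) ^ 2 * (l * (1 + l)) / 2) - l * ε ≤ -2 * (V * l ^ 2) := by
  have ht0 : 0 < t := by linarith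
  have h1 : M * (1 / t) ^ 2 ≤ 2 * V := by
    rw [one_div, inv_pow, ← div_eq_mul_inv, div_le_iff₀ (by positivity)]
    have h2 : n / t ≤ V * t ^ 2 := by
      rw [div_le_iff₀ ht0]
      linarith
    have h3 : 1 ≤ t ^ 2 := one_le_pow₀ ht
    nlinarith
  have h4 := mul_le_mul_of_nonneg_right h1 (show 0 ≤ l * (1 + l) / 2 by positivity)
  have h5 : 0 ≤ V * l := by positivity
  have h6 : 0 ≤ V * l ^ 2 := by positivity
  rw [hε]
  linarith

/-- Rounding `u / v` up to `t` is measured by `s = √(t v / u)`. The switches cost at most `v u ^ 2 /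
s ^ 2`; the tuned `γ` balances the two EXP3 terms, whose sum is at most `v u ^ 2 s` because `4 c ≤
7`. Since `1 ≤ s` and `s ^ 2 ≤ 2`, rounding up is harmless. -/
theorem batch_regret_le {u v t c γ m r : ℝ} (hv : 0 < v) (huv : 2 * v ≤ u)
    (ht1 : u ≤ t * v) (ht2 : t * v ≤ u + v) (hc0 : 0 < c) (hc : 4 * c ≤ 7) (hγ0 : 0 < γ)
    (hγ : γ ^ 2 * (c * u ^ 3) = v ^ 3 / 7 * t) (hm : m ≤ u ^ 3 / t) (hr : r ≤ u / v) :
    m + t * (c * γ * m + v ^ 3 / 7 / γ) + r ≤ 2 * (v * u ^ 2) + u / v := by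
  have hu : 0 < u := by linarith
  have ht : 0 < t := pos_of_mul_pos_left (hu.trans_le ht1) hv.le
  set s := Real.sqrt (t * v / u) with hs
  have hs2 : s ^ 2 = t * v / u := Real.sq_sqrt (by positivity)
  have hs1 : 1 ≤ s := Real.one_le_sqrt.2 (by rwa [one_le_div hu])
  have hs3 : s ^ 2 ≤ 2 := by
    rw [hs2, div_le_iff₀ hu]
    linarith
  have h1 : 2 * (c * u ^ 3) * γ ≤ v * u ^ 2 * s := by
    refine le_of_sq_le_sq ?_ (by positivity)
    have e1 : (2 * (c * u ^ 3) * γ) ^ 2 = 4 * c * (u ^ 3 * (v ^ 3 / 7 * t)) := by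
      rw [← hγ]; ring
    have e2 : (v * u ^ 2 * s) ^ 2 = 7 * (u ^ 3 * (v ^ 3 / 7 * t)) := by
      rw [mul_pow, hs2]; field_simp
    rw [e1, e2]
    gcongr
  have h2 : v ^ 3 / 7 * t / γ = c * u ^ 3 * γ := by
    rw [← hγ]; field_simp
  have h3 : t * m ≤ u ^ 3 := by
    rw [le_div_iff₀ ht] at hm
    linarith
  have h4 : u ^ 3 / t = v * u ^ 2 / s ^ 2 := by
    rw [hs2]; field_simp
  have h5 : 1 / s ^ 2 + s ≤ 2 := by
    rw [div_add' _ _ _ (by positivity), div_le_iff₀ (by positivity)]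
    -- The claim is `(s - 1) (1 + s - s ^ 2) ≥ 0`.
    nlinarith [mul_nonneg (sub_nonneg.2 hs1) (show 0 ≤ 1 + s - s ^ 2 by linarith)]
  have h6 : v * u ^ 2 / s ^ 2 + v * u ^ 2 * s ≤ 2 * (v * u ^ 2) := by
    calc _ = (v * u ^ 2) * (1 / s ^ 2 + s) := by ring
      _ ≤ (v * u ^ 2) * 2 := by gcongr
      _ = _ := by ring
  have h7 : t * (c * γ * m + v ^ 3 / 7 / γ) = c * γ * (t * m) + v ^ 3 / 7 * t / γ := by ring
  have h8 := mul_le_mul_of_nonneg_left h3 (mul_nonneg hc0.le hγ0.le)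
  rw [h7, h2]
  rw [h4] at hm
  linarith

end parameters

/-! ### The two bounds for the tuned algorithm -/

theorem agentRegret_exp3Tau_le {K T τ : ℕ} [NeZero K] (hK : 2 ≤ K) (hT : 1 ≤ T) {u v : ℝ}
    (hu : 0 < u) (hv : 0 < v) (hu3 : u ^ 3 = T) (hv3 : v ^ 3 = 7 * K * Real.log K)
    (hτ : τ = ⌈u / v⌉₊) {g : ℕ → Fin K → ℝ} (hg : ∀ t i, g t i ∈ Set.Icc (0 : ℝ) 1) :
    agentRegret (exp3Tau K T τ) (switchingCosts g) T ≤ 2 * (v * u ^ 2) + u / v := by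
  have hτ0 : 0 < τ := by rw [hτ]; exact Nat.ceil_pos.2 (div_pos hu hv)
  have hτ' : (0 : ℝ) < τ := by exact_mod_cast hτ0
  have hT' : (0 : ℝ) < T := by exact_mod_cast hT
  have ht1 : u / v ≤ τ := by rw [hτ]; exact Nat.le_ceil _
  have ht2 : (τ : ℝ) < u / v + 1 := by rw [hτ]; exact Nat.ceil_lt_add_one (div_pos hu hv).le
  rcases le_total u (2 * v) with huv | huv
  -- For few rounds the trivial bound `T = u ^ 3 ≤ 2 v u ^ 2` suffices.
  · refine (abs_le.1 (abs_agentRegret_switchingCosts_le _ hg T)).2.trans ?_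
    rw [← hu3]
    have h1 := mul_le_mul_of_nonneg_right huv (sq_nonneg u)
    have h2 := div_pos hu hv
    linarith
  · have hL := one_lt_mul_log hK
    have he : 0 < Real.exp 1 - 1 := by linarith [Real.exp_one_gt_d9]
    have hN : (0 : ℝ) < T / τ := div_pos hT' hτ'
    have hγ0 := exp3Rate_pos hK hN
    have ht1' : u ≤ τ * v := (div_le_iff₀ hv).1 ht1
    have ht2' : τ * v ≤ u + v := by
      have h := mul_le_mul_of_nonneg_right ht2.le hv.le
      rwa [add_mul, div_mul_cancel₀ _ hv.ne', one_mul] at h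
    have hLv : (K : ℝ) * Real.log K = v ^ 3 / 7 := by rw [hv3]; ring
    -- For `2 v ≤ u` the cap at 1 in the definition of the rate is inactive.
    have harg : (K : ℝ) * Real.log K / ((Real.exp 1 - 1) * (T / τ)) ≤ 1 := by
      rw [div_le_one (mul_pos he hN), mul_div_assoc', le_div_iff₀ hτ', hLv, ← hu3]
      have h1 : 1 ≤ Real.exp 1 - 1 := by linarith [Real.exp_one_gt_d9]
      have h2 : v ^ 2 * (τ * v) ≤ v ^ 2 * (2 * u) :=
        mul_le_mul_of_nonneg_left (by linarith) (sq_nonneg v)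
      have h3 : v ^ 2 * (2 * u) ≤ u ^ 2 * (2 * u) := by gcongr; linarith
      have h4 : 0 < u ^ 3 := by positivity
      nlinarith
    have hγ : (exp3Rate K (T / τ)).1 ^ 2 * ((Real.exp 1 - 1) * u ^ 3) = v ^ 3 / 7 * τ := by
      have h1 : (exp3Rate K (T / τ)).1
          = Real.sqrt (K * Real.log K / ((Real.exp 1 - 1) * (T / τ))) :=
        min_eq_right (Real.sqrt_le_one.2 harg)
      rw [h1, Real.sq_sqrt (by positivity), hu3, hLv]
      field_simp
    have hr : ((T % τ : ℕ) : ℝ) ≤ u / v := by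
      have h1 : T % τ + 1 ≤ τ := Nat.mod_lt _ hτ0
      have h2 : ((T % τ : ℕ) : ℝ) + 1 ≤ τ := by exact_mod_cast h1
      linarith
    refine (agentRegret_miniBatch_exp3_le hg hτ0 hT _ hγ0).trans ?_
    rw [hLv]
    exact batch_regret_le hv huv ht1' ht2' he (by linarith [Real.exp_one_lt_d9]) hγ0 hγ
      (by rw [hu3]; exact Nat.cast_div_le) hr

theorem isDPUpTo_exp3Tau {K T τ : ℕ} [NeZero K] (hK : 2 ≤ K) (hT : 1 ≤ T) (hτ0 : 0 < τ)
    (hτ : (T : ℝ) ≤ 7 * K * Real.log K * (τ : ℝ) ^ 3) :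
    IsDPUpTo (exp3Tau K T τ)
      (28 * K * Real.log K + Real.sqrt (112 * K * Real.log K * Real.log T)) ((T : ℝ) ^ (-2 : ℤ))
      T := by
  intro g g' hg hg' ⟨s₀, hs⟩ S
  have hT' : (1 : ℝ) ≤ T := by exact_mod_cast hT
  have hT0 : (0 : ℝ) < T := by linarith
  have hτ1 : (1 : ℝ) ≤ τ := by exact_mod_cast hτ0
  have hL := one_lt_mul_log hK
  have hlog : 0 ≤ Real.log T := Real.log_nonneg hT'
  set V : ℝ := 7 * K * Real.log K with hV
  have hV1 : 1 ≤ V := by rw [hV]; linarith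
  -- With this order `V l ^ 2 = ln T`, so the exponent bound `-2 V l ^ 2` yields `δ = T ^ (-2)`.
  set l := Real.sqrt (Real.log T / V) with hl
  have hl0 : 0 ≤ l := Real.sqrt_nonneg _
  have hl2 : V * l ^ 2 = Real.log T := by
    rw [hl, Real.sq_sqrt (by positivity), mul_div_cancel₀ _ (by linarith)]
  have hε : 28 * K * Real.log K + Real.sqrt (112 * K * Real.log K * Real.log T)
      = 4 * V + 4 * V * l := by
    have h1 : 112 * K * Real.log K * Real.log T = (4 * V * l) ^ 2 := by
      rw [← hl2, hV]; ring
    rw [h1, Real.sqrt_sq (by positivity), hV]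
    ring
  have hM : (((T - 1) / τ + 1 : ℕ) : ℝ) ≤ T / τ + 1 := by
    have h1 : (T - 1) / τ ≤ T / τ := Nat.div_le_div_right (Nat.sub_le _ _)
    have h2 : (((T - 1) / τ : ℕ) : ℝ) ≤ (T / τ : ℕ) := by exact_mod_cast h1
    push_cast
    linarith [Nat.cast_div_le (α := ℝ) (m := T) (n := τ)]
  refine (exp3_miniBatch_sum_seqProb_le hτ0 hT _ (exp3Rate_pos hK (by positivity)) hl0 hg hg' hs
    S).trans (add_le_add_left ?_ _)
  refine (Real.exp_le_exp.2 (privacy_exponent_le hV1 hτ1 hτ hM hl0 hε)).trans_eq ?_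
  rw [hl2, mul_comm, ← Real.rpow_def_of_pos hT0, ← Real.rpow_intCast]
  norm_num

end Bandit

theorem mainTheorem6 (K T : ℕ) [NeZero K] (hK : 2 ≤ K) (hT : 1 ≤ T) (τ : ℕ)
    (hτ : τ = ⌈(7 * (K : ℝ) * Real.log K) ^ (-(1 / 3) : ℝ) * (T : ℝ) ^ (1 / 3 : ℝ)⌉₊) :
    Bandit.IsDPUpTo (Bandit.exp3Tau K T τ)
      (28 * K * Real.log K + Real.sqrt (112 * K * Real.log K * Real.log T))
      ((T : ℝ) ^ (-2 : ℤ)) T ∧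
    ∀ {Ω : Type*} [MeasurableSpace Ω] (P : Measure Ω) [IsProbabilityMeasure P]
      (g : Ω → ℕ → Fin K → ℝ),
      (∀ t i, Measurable fun ω => g ω t i) →
      (∀ ω t i, g ω t i ∈ Set.Icc (0 : ℝ) 1) →
      Integrable
        (fun ω => Bandit.agentRegret (Bandit.exp3Tau K T τ) (Bandit.switchingCosts (g ω)) T) P ∧
      ∫ ω, Bandit.agentRegret (Bandit.exp3Tau K T τ) (Bandit.switchingCosts (g ω)) T ∂P
        ≤ 2 * (7 * (K : ℝ) * Real.log K) ^ (1 / 3 : ℝ) * (T : ℝ) ^ (2 / 3 : ℝ)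
          + (7 * (K : ℝ) * Real.log K) ^ (-(1 / 3) : ℝ) * (T : ℝ) ^ (1 / 3 : ℝ) := by
  have hT' : (0 : ℝ) < T := by exact_mod_cast hT
  have hL := Bandit.one_lt_mul_log hK
  have hV : 0 < 7 * (K : ℝ) * Real.log K := by linarith
  set V := 7 * (K : ℝ) * Real.log K with hVd
  set u := (T : ℝ) ^ (1 / 3 : ℝ) with hud
  set v := V ^ (1 / 3 : ℝ) with hvd
  have hu : 0 < u := Real.rpow_pos_of_pos hT' _
  have hv : 0 < v := Real.rpow_pos_of_pos hV _
  have hu3 : u ^ 3 = T := by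
    rw [hud, ← Real.rpow_natCast, ← Real.rpow_mul hT'.le]; norm_num
  have hv3 : v ^ 3 = V := by
    rw [hvd, ← Real.rpow_natCast, ← Real.rpow_mul hV.le]; norm_num
  have hu2 : (T : ℝ) ^ (2 / 3 : ℝ) = u ^ 2 := by
    rw [hud, ← Real.rpow_natCast, ← Real.rpow_mul hT'.le]; norm_num
  have huv : V ^ (-(1 / 3) : ℝ) * u = u / v := by
    rw [Real.rpow_neg hV.le, ← hvd, inv_mul_eq_div]
  rw [huv] at hτ ⊢
  have hτ0 : 0 < τ := by rw [hτ]; exact Nat.ceil_pos.2 (div_pos hu hv)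
  refine ⟨Bandit.isDPUpTo_exp3Tau hK hT hτ0 ?_, ?_⟩
  · have h1 : u / v ≤ τ := by rw [hτ]; exact Nat.le_ceil _
    rw [div_le_iff₀ hv] at h1
    rw [← hu3, ← hVd, ← hv3, ← mul_pow, mul_comm v]
    gcongr
  · intro Ω _ P _ g hgm hg
    have hint : Integrable (fun ω =>
        Bandit.agentRegret (Bandit.exp3Tau K T τ) (Bandit.switchingCosts (g ω)) T) P :=
      -- The regret is a measurable function of the gains and is bounded by `T` in absolute value.
      Integrable.of_bound (Bandit.measurable_agentRegret_miniBatch_exp3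
        _ (Bandit.measurable_switchingCosts hgm) hτ0 hT).aestronglyMeasurable T
        (Filter.Eventually.of_forall fun ω => Bandit.abs_agentRegret_switchingCosts_le _ (hg ω) T)
    refine ⟨hint, ?_⟩
    calc _ ≤ ∫ _, (2 * (v * u ^ 2) + u / v) ∂P :=
          integral_mono hint (integrable_const _) fun ω =>
            Bandit.agentRegret_exp3Tau_le hK hT hu hv hu3 hv3 hτ (hg ω)
      _ = _ := by
          rw [integral_const, hu2]
          simp
          ring
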